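/- There is a universal constant $C\ge 1$ such that the following holds. Let $k\ge 1$, let $d$ be a power of $2$, and let $A=BDHD'$ be the random $k\times d$ matrix in which: $B$ is a $4$-wise independent $k\times d$ code matrix, i.e. all entries of $B$ are $\pm k^{-1/2}$ and for all rows $1\le i_1<i_2<i_3<i_4\le k$ and all $(b_1,b_2,b_3,b_4)\in\{1,-1\}^4$ exactly $d/16$ columns $j$ satisfy $(B_{i_1j},B_{i_2j},B_{i_3j},B_{i_4j})=k^{-1/2}(b_1,b_2,b_3,b_4)$; $H$ is the $d\times d$ Walsh–Hadamard matrix ($H_1=[1]$, $H_{2m}=\frac1{\sqrt2}\begin{bmatrix}H_m&H_m\\H_m&-H_m\end{bmatrix}$); and $D$, $D'$ are independent random diagonal matrices whose diagonal entries are independent and equal to $\pm1$ with probability $1/2$ each. Let $S\subset\{x\in\mathbb{R}^d:\|x\|_2=1\}$ be any subset and let $\varepsilon,p\in(0,1)$. If \[k\ \ge\ \frac{C}{\varepsilon^{4}}\left(\left(\ln\frac1p\right)^{3/4}+\sum_{j=0}^{\infty}\frac{1}{2^{j}}\left(\ln N\left(S,\|\cdot\|_2,\frac{1}{2^{j}}\right)\right)^{3/4}\right)^{2}\]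 and, in case $p>1/2$, also $k\ge C\varepsilon^{-2}$, then with probability at least $1-p$ the matrix $A$ is an $\varepsilon$-JL map of $S$ into $\mathbb{R}^k$, i.e. $(1-\varepsilon)\|x\|_2^2\le\|Ax\|_2^2\le(1+\varepsilon)\|x\|_2^2$ for all $x\in S$. Here $N(S,\|\cdot\|_2,r)$ is the least number of closed Euclidean balls of radius $r$ with centres in $S$ that cover $S$ (for $S=\emptyset$ the sum is read as $0$). The constant $C$, and hence the bound on $k$, does not depend on the ambient dimension $d$. -/

import Mathlib

open MeasureTheory ProbabilityTheory
open scoped ENNReal NNReal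

/-- The Walsh-Hadamard matrix `H_d` of size `d = 2 ^ n`: `H_1 = [1]`, and `H_{2d}` is
`1 / √2` times the block matrix `[H_d, H_d; H_d, -H_d]`. -/
noncomputable def walshHadamard : (n : ℕ) → Matrix (Fin (2 ^ n)) (Fin (2 ^ n)) ℝ
  | 0 => 1
  | n + 1 =>
    (1 / √2) • Matrix.reindex
      (finSumFinEquiv.trans (finCongr (by rw [pow_succ]; omega)))
      (finSumFinEquiv.trans (finCongr (by rw [pow_succ]; omega)))
      (Matrix.fromBlocks (walshHadamard n) (walshHadamard n)
        (walshHadamard n) (-walshHadamard n))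

/-- A `k × d` code matrix (all entries are `± k ^ (-1/2)`) is 4-wise independent if, for any four
rows `i₁ < i₂ < i₃ < i₄`, each of the 16 sign patterns `k ^ (-1/2) (b₁, b₂, b₃, b₄)` is attained
on these rows by exactly `d / 16` of the columns. -/
structure IsFourWiseIndependent {k d : ℕ} (B : Matrix (Fin k) (Fin d) ℝ) : Prop where
  /-- All entries are `± k ^ (-1/2)`. -/
  entry : ∀ i j, B i j = 1 / √(k : ℝ) ∨ B i j = -1 / √(k : ℝ)
  /-- Every sign pattern appears equally often on any four rows. -/
  pattern : ∀ i : Fin 4 → Fin k, StrictMono i →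
    ∀ b : Fin 4 → ℝ, (∀ a, b a = 1 ∨ b a = -1) →
      16 * Set.ncard {j : Fin d | ∀ a, B (i a) j = b a / √(k : ℝ)} = d

/-- A Rademacher family: independent random variables, each of which takes the values `1` and
`-1` with probability `1/2`. -/
structure IsRademacher {Ω ι : Type*} [MeasurableSpace Ω] (P : Measure Ω) (ξ : ι → Ω → ℝ) :
    Prop where
  /-- Every member is a random variable. -/
  measurable : ∀ i, Measurable (ξ i)
  /-- The members are mutually independent. -/
  indep : iIndepFun ξ P
  /-- The value `1` has probability `1/2`. -/
  prob_one : ∀ i, P {ω | ξ i ω = 1} = 1 / 2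
  /-- The value `-1` has probability `1/2`. -/
  prob_neg_one : ∀ i, P {ω | ξ i ω = -1} = 1 / 2

/-- The matrix `B D H D'`, where `D` and `D'` are the diagonal matrices with diagonals
`ξ` and `ξ'`, and `H` is the Walsh-Hadamard matrix. -/
noncomputable def jlMatrix {k n : ℕ} (B : Matrix (Fin k) (Fin (2 ^ n)) ℝ)
    (ξ ξ' : Fin (2 ^ n) → ℝ) : Matrix (Fin k) (Fin (2 ^ n)) ℝ :=
  B * Matrix.diagonal ξ * walshHadamard n * Matrix.diagonal ξ'

/-- `A` is an `ε`-JL map of `S` into `ℝᵏ`: it preserves the squared Euclidean norms of all elements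
of `S` up to the factor `1 ± ε`. -/
def IsJLMap {k d : ℕ} (ε : ℝ) (A : Matrix (Fin k) (Fin d) ℝ)
    (S : Set (EuclideanSpace ℝ (Fin d))) : Prop :=
  ∀ x ∈ S, (1 - ε) * ‖x‖ ^ 2 ≤ ‖A.toEuclideanLin x‖ ^ 2 ∧
    ‖A.toEuclideanLin x‖ ^ 2 ≤ (1 + ε) * ‖x‖ ^ 2

/-- The series `∑ⱼ 2⁻ʲ (ln N(S, ‖·‖₂, 2⁻ʲ)) ^ (3/4)` of nonnegative terms, as an element of
`[0, ∞]`. Here `N` is the covering number by closed balls with centres in `S`; it is finite, since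
the theorem applies this to bounded sets only. -/
noncomputable def entropySum {d : ℕ} (S : Set (EuclideanSpace ℝ (Fin d))) : ℝ≥0∞ :=
  ∑' j : ℕ, ENNReal.ofReal
    (1 / 2 ^ j * Real.log ((Metric.coveringNumber (1 / 2 ^ j : ℝ≥0) S).toNat : ℝ) ^ (3 / 4 : ℝ))

open scoped BigOperators Matrix

/-! For a unit vector x and fixed `ξ'`, put y = H(x · ξ'). Then Ax = Mξ with M = B diag(y), a
Rademacher sum whose matrix has Frobenius norm ‖y‖ = 1. A Hanson–Wright type bound,
`finProb_abs_sqrt_sumSq_sub_one_le`, gives |‖Mξ‖ − 1| ≲ ‖M‖√L outside probability 2e^{-L}. Two facts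
control the operator norm ‖M‖. By four-wise independence the fourth moments of Bᵀu over the columns
are those of a Rademacher sum, so Bᵀ is bounded from ℓ² to ℓ⁴; Cauchy–Schwarz and duality give ‖M‖²
≲ √d ‖y‖₄² / k (`IsFourWiseIndependent.opSqLE_mul_diagonal`). The signs `ξ'` flatten x: √d ‖y‖₄² ≲
√L outside probability e^{-L} (`finProb_spread_le`). Together the distortion of one vector is ≲
L^{3/4}/√k. This is where the exponent 3/4 comes from, and d has cancelled.

Both exponential moment bounds rest on one bootstrap. Decouple the quadratic expression, integrate
out one of the two independent halves, and recognise an exponential moment of the original kind at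
half strength. Starting from a trivial bound that depends on the dimension, iterating c ↦ a + c/2
washes that dependence out (`bound_of_self_improving`).

Passing to all of S is chaining over minimal dyadic nets (`exists_norm_map_sub_le_of_nets`), with a
union bound over net points and over pairs from consecutive nets. The bound on an increment is (1 +
δ) times its length; the summand 1 contributes about 2^{-J} when the chain starts at level J, so J
is chosen with 2^{-J} comparable to ε. The entropy term of the starting net is then only bounded by
2^J ≈ 1/ε times the entropy sum, and asking that it be ≲ ε√k produces the factor ε^{-4} in the bound
on k. -/

/-- The real sign attached to a Boolean. -/
def sgn (b : Bool) : ℝ := if b then 1 else -1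

lemma sgn_mul_self (b : Bool) : sgn b * sgn b = 1 := by cases b <;> simp [sgn]

lemma sgn_sq (b : Bool) : sgn b ^ 2 = 1 := by cases b <;> simp [sgn]

lemma sgn_not (b : Bool) : sgn (!b) = -sgn b := by cases b <;> simp [sgn]

/-! ### Averages over sign vectors: decoupling and exponential moments. -/

section SignAverage

variable {ι : Type*} [Fintype ι] [DecidableEq ι]

/-- Flip one coordinate of a sign vector. -/
def flipSign (i : ι) : (ι → Bool) ≃ (ι → Bool) where
  toFun s := Function.update s i (!s i)
  invFun s := Function.update s i (!s i)
  left_inv s := by simp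
  right_inv s := by simp

lemma expect_flipSign (i : ι) (f : (ι → Bool) → ℝ) :
    𝔼 s, f (flipSign i s) = 𝔼 s, f s :=
  Fintype.expect_equiv (flipSign i) _ _ fun _ => rfl

lemma expect_sgn_mul_sgn {i j : ι} (hij : i ≠ j) :
    𝔼 s : ι → Bool, sgn (s i) * sgn (s j) = 0 := by
  have h := expect_flipSign i fun s : ι → Bool => sgn (s i) * sgn (s j)
  have h2 : ∀ s : ι → Bool, sgn (flipSign i s i) * sgn (flipSign i s j)
      = -(sgn (s i) * sgn (s j)) := by
    intro s
    simp [flipSign, Function.update_of_ne hij.symm, sgn_not]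
  simp only [h2, Finset.expect_neg_distrib] at h
  linarith

lemma expect_signSum_sq (c : ι → ℝ) :
    𝔼 s : ι → Bool, (∑ i, sgn (s i) * c i) ^ 2 = ∑ i, c i ^ 2 := by
  have h1 : ∀ s : ι → Bool, (∑ i, sgn (s i) * c i) ^ 2
      = ∑ i, ∑ j, (c i * c j) * (sgn (s i) * sgn (s j)) := by
    intro s
    rw [sq, Finset.sum_mul_sum]
    refine Finset.sum_congr rfl fun i _ => Finset.sum_congr rfl fun j _ => by ring
  simp only [h1, Finset.expect_sum_comm, ← Finset.mul_expect]
  refine Finset.sum_congr rfl fun i _ => ?_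
  rw [Finset.sum_eq_single i]
  · simp [sgn_mul_self, sq]
  · intro j _ hji
    rw [expect_sgn_mul_sgn hji.symm, mul_zero]
  · simp

/-- The indicator of the coordinates selected by `τ`. -/
def sel (τ : ι → Bool) (i : ι) : ℝ := if τ i then 1 else 0

/-- The indicator of the coordinates not selected by `τ`. -/
def unsel (τ : ι → Bool) (i : ι) : ℝ := if τ i then 0 else 1

/-- For a random splitting, the product of the two partial sums is a quarter of the difference
between the squares of the full sum and of the sum signed by τ; the latter averages to the diagonal.
-/
lemma sq_sum_decouple (c : ι → ℝ) :
    (∑ i, c i) ^ 2 = ∑ i, c i ^ 2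
      + 4 * 𝔼 τ : ι → Bool, (∑ i, sel τ i * c i) * ∑ i, unsel τ i * c i := by
  have h1 : ∀ τ : ι → Bool, (∑ i, sel τ i * c i) * ∑ i, unsel τ i * c i
      = (1 / 4) * (∑ i, c i) ^ 2 - (1 / 4) * (∑ i, sgn (τ i) * c i) ^ 2 := by
    intro τ
    have ha : ∑ i, c i = ∑ i, sel τ i * c i + ∑ i, unsel τ i * c i := by
      rw [← Finset.sum_add_distrib]
      refine Finset.sum_congr rfl fun i _ => ?_
      unfold sel unsel; split_ifs <;> ring
    have hb : ∑ i, sgn (τ i) * c i = ∑ i, sel τ i * c i - ∑ i, unsel τ i * c i := by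
      rw [← Finset.sum_sub_distrib]
      refine Finset.sum_congr rfl fun i _ => ?_
      unfold sel unsel sgn; split_ifs <;> ring
    rw [ha, hb]; ring
  simp only [h1, Finset.expect_sub_distrib, ← Finset.mul_expect, expect_signSum_sq,
    Fintype.expect_const]
  ring

/-- The sign vector that agrees with `s` where `τ` selects and with `t` elsewhere. -/
def mixSign (τ s t : ι → Bool) : ι → Bool := fun i => if τ i then s i else t i

lemma mixSign_mixSign {κ : Type*} (τ s t : κ → Bool) : mixSign τ (mixSign τ s t) (mixSign τ t s) = s := by
  funext i
  unfold mixSign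
  split_ifs <;> rfl

/-- Exchange two sign vectors where `τ` does not select. -/
def mixEquiv (τ : ι → Bool) : ((ι → Bool) × (ι → Bool)) ≃ ((ι → Bool) × (ι → Bool)) where
  toFun p := (mixSign τ p.1 p.2, mixSign τ p.2 p.1)
  invFun p := (mixSign τ p.1 p.2, mixSign τ p.2 p.1)
  left_inv p := Prod.ext (mixSign_mixSign τ p.1 p.2) (mixSign_mixSign τ p.2 p.1)
  right_inv p := Prod.ext (mixSign_mixSign τ p.1 p.2) (mixSign_mixSign τ p.2 p.1)

/-- This replaces the signs outside the selected set by an independent copy, the second half of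
decoupling: `mixEquiv` is a bijection on pairs, so the mixture is again uniform. -/
lemma expect_mixSign (τ : ι → Bool) (f : (ι → Bool) → ℝ) :
    𝔼 s, 𝔼 t, f (mixSign τ s t) = 𝔼 s, f s := by
  have h := Fintype.expect_equiv (mixEquiv τ) (fun p => f (mixSign τ p.1 p.2))
    (fun p => f p.1) fun _ => rfl
  have h1 := Finset.expect_product' (M := ℝ) (Finset.univ : Finset (ι → Bool))
    (Finset.univ : Finset (ι → Bool)) fun s t => f (mixSign τ s t)
  have h2 := Finset.expect_product' (M := ℝ) (Finset.univ : Finset (ι → Bool))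
    (Finset.univ : Finset (ι → Bool)) fun s _ => f s
  rw [← h1, Finset.univ_product_univ, h, ← Finset.univ_product_univ, h2]
  simp only [Fintype.expect_const]

/-- The average factors over coordinates into hyperbolic cosines, and cosh c ≤ exp(c²/2). -/
lemma expect_exp_signSum_le (c : ι → ℝ) :
    𝔼 s : ι → Bool, Real.exp (∑ i, sgn (s i) * c i) ≤ Real.exp ((∑ i, c i ^ 2) / 2) := by
  rw [Fintype.expect_eq_sum_div_card]
  have h : ∑ s : ι → Bool, Real.exp (∑ i, sgn (s i) * c i)
      = ∏ i, ∑ b : Bool, Real.exp (sgn b * c i) := by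
    rw [Fintype.prod_sum]
    exact Finset.sum_congr rfl fun s _ => Real.exp_sum _ _
  rw [h, div_le_iff₀ (by positivity), Finset.sum_div, Real.exp_sum]
  have hc : ((Fintype.card (ι → Bool) : ℕ) : ℝ) = ∏ _i : ι, (2 : ℝ) := by simp
  rw [hc, ← Finset.prod_mul_distrib]
  refine Finset.prod_le_prod (fun i _ => by positivity) fun i _ => ?_
  have := Real.cosh_le_exp_half_sq (c i)
  rw [Real.cosh_eq] at this
  simp [sgn]
  linarith

/-- Jensen's inequality, by the tangent line of exp at the mean. -/
lemma exp_expect_le {α : Type*} [Fintype α] [Nonempty α] (f : α → ℝ) :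
    Real.exp (𝔼 a, f a) ≤ 𝔼 a, Real.exp (f a) := by
  set m := 𝔼 a, f a with hm
  have h : ∀ a, Real.exp m * (1 + (f a - m)) ≤ Real.exp (f a) := by
    intro a
    calc Real.exp m * (1 + (f a - m)) ≤ Real.exp m * Real.exp (f a - m) := by
          gcongr; linarith [Real.add_one_le_exp (f a - m)]
      _ = Real.exp (f a) := by rw [← Real.exp_add]; ring_nf
  have h2 := Finset.expect_le_expect (s := Finset.univ) fun a _ => h a
  rw [← Finset.mul_expect, Finset.expect_add_distrib, Finset.expect_sub_distrib,
    Fintype.expect_const, Fintype.expect_const, ← hm] at h2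
  linarith

/-- After normalising to variance one, use x⁴ ≤ 24(eˣ + e⁻ˣ); the constant is 48 · exp(1/2) rounded
up. -/
lemma expect_signSum_pow_four_le (c : ι → ℝ) :
    𝔼 s : ι → Bool, (∑ i, sgn (s i) * c i) ^ 4 ≤ 80 * (∑ i, c i ^ 2) ^ 2 := by
  set F := ∑ i, c i ^ 2 with hF
  have hF0 : 0 ≤ F := Finset.sum_nonneg fun i _ => sq_nonneg _
  rcases hF0.eq_or_lt with h0 | hpos
  · have hc : ∀ i, c i = 0 := fun i => by
      have := (Finset.sum_eq_zero_iff_of_nonneg (fun i _ => sq_nonneg (c i))).1 h0.symm i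
        (Finset.mem_univ i)
      exact pow_eq_zero_iff (two_ne_zero) |>.1 this
    simp [hc, ← h0]
  · set r := √F with hr
    have hrpos : 0 < r := Real.sqrt_pos.2 hpos
    have hr2 : r ^ 2 = F := Real.sq_sqrt hF0
    have key : ∀ x : ℝ, x ^ 4 ≤ 24 * (Real.exp x + Real.exp (-x)) := by
      have h4 : ∀ y : ℝ, 0 ≤ y → y ^ 4 ≤ 24 * Real.exp y := by
        intro y hy
        have := Real.pow_div_factorial_le_exp y hy 4
        norm_num [Nat.factorial] at this
        linarith
      intro x
      rcases le_total 0 x with hx | hx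
      · linarith [h4 x hx, Real.exp_pos (-x)]
      · have := h4 (-x) (by linarith)
        rw [Even.neg_pow (by decide)] at this
        linarith [Real.exp_pos x]
    have hs : ∀ s : ι → Bool, (∑ i, sgn (s i) * c i) ^ 4
        ≤ F ^ 2 * (24 * (Real.exp (∑ i, sgn (s i) * (c i / r))
          + Real.exp (∑ i, sgn (s i) * (-(c i / r))))) := by
      intro s
      have e1 : ∑ i, sgn (s i) * (c i / r) = (∑ i, sgn (s i) * c i) / r := by
        rw [Finset.sum_div]; exact Finset.sum_congr rfl fun i _ => by ring
      have e2 : ∑ i, sgn (s i) * (-(c i / r)) = -((∑ i, sgn (s i) * c i) / r) := by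
        rw [← e1, ← Finset.sum_neg_distrib]; exact Finset.sum_congr rfl fun i _ => by ring
      rw [e1, e2]
      have := key ((∑ i, sgn (s i) * c i) / r)
      rw [div_pow, show r ^ 4 = F ^ 2 by rw [← hr2]; ring, div_le_iff₀ (by positivity)] at this
      linarith
    have hsum : ∑ i, (c i / r) ^ 2 = 1 := by
      simp only [div_pow]
      rw [← Finset.sum_div, hr2, ← hF, div_self hpos.ne']
    have m1 := expect_exp_signSum_le fun i => c i / r
    have m2 := expect_exp_signSum_le fun i => -(c i / r)
    simp only [neg_sq, hsum] at m1 m2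
    have h2 := Finset.expect_le_expect (s := Finset.univ) fun s _ => hs s
    rw [← Finset.mul_expect, ← Finset.mul_expect, Finset.expect_add_distrib] at h2
    have hexp : Real.exp (1 / 2) ≤ 1.66 := by
      have h := Real.exp_one_lt_d9
      have : Real.exp (1/2) ^ 2 = Real.exp 1 := by rw [← Real.exp_nat_mul]; norm_num
      nlinarith [Real.exp_pos (1/2)]
    have hF2 : 0 < F ^ 2 := by positivity
    nlinarith

end SignAverage

/-! ### A Hanson–Wright inequality for Rademacher sums of vectors. -/

section Chaos

variable {ι κ μ : Type*} [Fintype ι] [Fintype κ] [Fintype μ]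

/-- The sum of the squares of the entries of a vector. -/
def sumSq (v : ι → ℝ) : ℝ := ∑ i, v i ^ 2

/-- The squared Frobenius norm. -/
def frobSq (M : Matrix κ ι ℝ) : ℝ := ∑ j, sumSq (M j)

/-- The squared operator norm of `M` is at most `b`. -/
def OpSqLE (M : Matrix κ ι ℝ) (b : ℝ) : Prop := ∀ v, sumSq (M *ᵥ v) ≤ b * sumSq v

/-- The real sign vector attached to a Boolean vector. -/
def signVec {ι : Type*} (s : ι → Bool) : ι → ℝ := fun i => sgn (s i)

lemma sumSq_nonneg (v : ι → ℝ) : 0 ≤ sumSq v := Finset.sum_nonneg fun _ _ => sq_nonneg _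

lemma frobSq_nonneg (M : Matrix κ ι ℝ) : 0 ≤ frobSq M := Finset.sum_nonneg fun _ _ => sumSq_nonneg _

lemma sumSq_smul (a : ℝ) (v : ι → ℝ) : sumSq (a • v) = a ^ 2 * sumSq v := by
  simp [sumSq, mul_pow, Finset.mul_sum]

lemma frobSq_smul (a : ℝ) (M : Matrix κ ι ℝ) : frobSq (a • M) = a ^ 2 * frobSq M := by
  unfold frobSq
  rw [Finset.mul_sum]
  exact Finset.sum_congr rfl fun j _ => sumSq_smul a (M j)

lemma frobSq_transpose (M : Matrix κ ι ℝ) : frobSq Mᵀ = frobSq M := Finset.sum_comm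

lemma frobSq_eq_sum_col (M : Matrix κ ι ℝ) : frobSq M = ∑ i, sumSq (M.col i) := Finset.sum_comm

lemma dotProduct_sq_le (u v : ι → ℝ) : (u ⬝ᵥ v) ^ 2 ≤ sumSq u * sumSq v :=
  Finset.sum_mul_sq_le_sq_mul_sq _ _ _

lemma sumSq_eq_dotProduct (v : ι → ℝ) : sumSq v = v ⬝ᵥ v :=
  Finset.sum_congr rfl fun _ _ => sq _

lemma OpSqLE.transpose {M : Matrix κ ι ℝ} {b : ℝ} (h : OpSqLE M b) (hb : 0 ≤ b) :
    OpSqLE Mᵀ b := by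
  intro v
  set u := Mᵀ *ᵥ v with hu
  have h1 : sumSq u = v ⬝ᵥ (M *ᵥ u) := by
    rw [Matrix.dotProduct_mulVec, ← Matrix.mulVec_transpose, ← hu, sumSq_eq_dotProduct]
  have h2 : sumSq u ^ 2 ≤ sumSq v * (b * sumSq u) := by
    nth_rewrite 1 [h1]
    exact (dotProduct_sq_le _ _).trans (mul_le_mul_of_nonneg_left (h u) (sumSq_nonneg v))
  rcases (sumSq_nonneg u).eq_or_lt with h0 | h0
  · rw [← h0]; exact mul_nonneg hb (sumSq_nonneg v)
  · nlinarith

lemma OpSqLE.mul {M : Matrix μ κ ℝ} {N : Matrix κ ι ℝ} {a b : ℝ} (hM : OpSqLE M a)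
    (hN : OpSqLE N b) (ha : 0 ≤ a) : OpSqLE (M * N) (a * b) := by
  intro v
  rw [← Matrix.mulVec_mulVec, mul_assoc]
  exact (hM _).trans (mul_le_mul_of_nonneg_left (hN v) ha)

lemma OpSqLE.smul {M : Matrix κ ι ℝ} {b : ℝ} (hM : OpSqLE M b) (a : ℝ) :
    OpSqLE (a • M) (a ^ 2 * b) := by
  intro v
  rw [Matrix.smul_mulVec, sumSq_smul, mul_assoc]
  exact mul_le_mul_of_nonneg_left (hM v) (sq_nonneg a)

lemma OpSqLE.mono {M : Matrix κ ι ℝ} {a b : ℝ} (hM : OpSqLE M a) (hab : a ≤ b) : OpSqLE M b :=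
  fun v => (hM v).trans (mul_le_mul_of_nonneg_right hab (sumSq_nonneg v))

lemma frobSq_mul_le {M : Matrix μ κ ℝ} {a : ℝ} (hM : OpSqLE M a) (N : Matrix κ ι ℝ) :
    frobSq (M * N) ≤ a * frobSq N := by
  rw [frobSq_eq_sum_col, frobSq_eq_sum_col, Finset.mul_sum]
  exact Finset.sum_le_sum fun i _ => hM (N.col i)

lemma frobSq_mul_le' {N : Matrix κ ι ℝ} {b : ℝ} (hN : OpSqLE N b) (hb : 0 ≤ b)
    (M : Matrix μ κ ℝ) : frobSq (M * N) ≤ b * frobSq M := by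
  rw [← frobSq_transpose, Matrix.transpose_mul, ← frobSq_transpose M]
  exact frobSq_mul_le (hN.transpose hb) _

lemma opSqLE_frobSq (M : Matrix κ ι ℝ) : OpSqLE M (frobSq M) := by
  intro v
  unfold frobSq
  rw [Finset.sum_mul]
  exact Finset.sum_le_sum fun j _ => dotProduct_sq_le (M j) v

lemma sumSq_signVec (s : ι → Bool) : sumSq (signVec s) = Fintype.card ι := by
  simp [sumSq, signVec, sgn_sq]

variable [DecidableEq ι]

lemma opSqLE_diagonal {a : ι → ℝ} {b : ℝ} (h : ∀ i, a i ^ 2 ≤ b) :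
    OpSqLE (Matrix.diagonal a) b := by
  intro v
  unfold sumSq
  rw [Finset.mul_sum]
  refine Finset.sum_le_sum fun i _ => ?_
  rw [Matrix.mulVec_diagonal, mul_pow]
  exact mul_le_mul_of_nonneg_right (h i) (sq_nonneg _)

lemma sel_sq_le {α : Type*} (τ : α → Bool) (i : α) : sel τ i ^ 2 ≤ 1 := by
  unfold sel; split_ifs <;> simp

lemma unsel_sq_le {α : Type*} (τ : α → Bool) (i : α) : unsel τ i ^ 2 ≤ 1 := by
  unfold unsel; split_ifs <;> simp

/-- Decoupling of the squared norm of a Rademacher sum. -/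
lemma sumSq_mulVec_signVec_eq (M : Matrix κ ι ℝ) (s : ι → Bool) :
    sumSq (M *ᵥ signVec s) = frobSq M + 4 * 𝔼 τ : ι → Bool,
      (M *ᵥ (sel τ * signVec s)) ⬝ᵥ (M *ᵥ (unsel τ * signVec s)) := by
  have h : ∀ j, (M *ᵥ signVec s) j ^ 2 = sumSq (M j) + 4 * 𝔼 τ : ι → Bool,
      (M *ᵥ (sel τ * signVec s)) j * (M *ᵥ (unsel τ * signVec s)) j := by
    intro j
    have := sq_sum_decouple fun i => M j i * signVec s i
    simp only [mul_pow, signVec, sgn_sq, mul_one] at this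
    simp only [Matrix.mulVec, dotProduct, sumSq, signVec, Pi.mul_apply]
    rw [this]
    congr 2
    refine Finset.expect_congr rfl fun τ _ => ?_
    congr 1 <;> exact Finset.sum_congr rfl fun i _ => by ring
  unfold sumSq frobSq
  simp only [h, Finset.sum_add_distrib, ← Finset.mul_sum, ← Finset.expect_sum_comm]
  rfl

lemma sel_mul_mixSign {α : Type*} (τ s t : α → Bool) : sel τ * signVec (mixSign τ s t) = sel τ * signVec s := by
  funext i
  simp only [sel, signVec, mixSign, Pi.mul_apply]
  split_ifs <;> simp

lemma unsel_mul_mixSign {α : Type*} (τ s t : α → Bool) :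
    unsel τ * signVec (mixSign τ s t) = unsel τ * signVec t := by
  funext i
  simp only [unsel, signVec, mixSign, Pi.mul_apply]
  split_ifs <;> simp

/-- Bound the exponential moment of a decoupled function of a sign vector. -/
lemma expect_exp_le_of_decoupled (f : (ι → Bool) → ℝ)
    (g : (ι → Bool) → (ι → ℝ) → (ι → ℝ) → ℝ) (R : ℝ)
    (hf : ∀ s, f s ≤ 𝔼 τ, g τ (sel τ * signVec s) (unsel τ * signVec s))
    (hg : ∀ τ, 𝔼 s, 𝔼 t, Real.exp (g τ (sel τ * signVec s) (unsel τ * signVec t)) ≤ R) :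
    𝔼 s, Real.exp (f s) ≤ R := by
  calc 𝔼 s, Real.exp (f s)
      ≤ 𝔼 s, 𝔼 τ, Real.exp (g τ (sel τ * signVec s) (unsel τ * signVec s)) :=
        Finset.expect_le_expect fun s _ => (Real.exp_le_exp.2 (hf s)).trans (exp_expect_le _)
    _ = 𝔼 τ, 𝔼 s, Real.exp (g τ (sel τ * signVec s) (unsel τ * signVec s)) :=
        Finset.expect_comm _ _ _
    _ ≤ 𝔼 _τ : ι → Bool, R := by
        refine Finset.expect_le_expect fun τ _ => ?_
        rw [← expect_mixSign τ]
        simp only [sel_mul_mixSign, unsel_mul_mixSign]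
        exact hg τ
    _ = R := Fintype.expect_const R

/-- Once decoupled, the chaos is linear in the second sign vector. Integrating that vector out
leaves the exponential of a squared norm of a Rademacher sum with a new matrix N, whose operator and
Frobenius norms are small when λ and b are. -/
lemma expect_exp_chaos_step (M : Matrix κ ι ℝ) {lam b c : ℝ} (hM : OpSqLE M b) (hb : 0 ≤ b)
    (hc : 0 ≤ c)
    (hN : ∀ N : Matrix ι ι ℝ, OpSqLE N (8 * lam ^ 2 * b ^ 2) →
      𝔼 s, Real.exp (sumSq (N *ᵥ signVec s)) ≤ Real.exp (c * frobSq N)) :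
    𝔼 s, Real.exp (lam * (sumSq (M *ᵥ signVec s) - frobSq M))
      ≤ Real.exp (c * (8 * lam ^ 2 * (b * frobSq M))) := by
  refine expect_exp_le_of_decoupled _
    (fun _ u v => 4 * lam * ((M *ᵥ u) ⬝ᵥ (M *ᵥ v))) _ (fun s => ?_) fun τ => ?_
  · rw [sumSq_mulVec_signVec_eq, ← Finset.mul_expect]
    apply le_of_eq; ring
  · set D := Matrix.diagonal (unsel τ)
    set E := Matrix.diagonal (sel τ)
    have hD : OpSqLE D 1 := opSqLE_diagonal (unsel_sq_le τ)
    have hE : OpSqLE E 1 := opSqLE_diagonal (sel_sq_le τ)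
    have hMt := hM.transpose hb
    -- The subgaussian bound gives half the square of 4λ times the coefficient vector, hence 16/2 =
    -- 8.
    set N := (√8 * lam) • (D * (Mᵀ * (M * E))) with hNdef
    have hsq : (√8 * lam) ^ 2 = 8 * lam ^ 2 := by rw [mul_pow, Real.sq_sqrt (by norm_num)]
    have hNop : OpSqLE N (8 * lam ^ 2 * b ^ 2) := by
      have := (hD.mul (hMt.mul (hM.mul hE hb) hb) zero_le_one).smul (√8 * lam)
      rw [hsq] at this
      refine this.mono (le_of_eq (by ring))
    have hNF : frobSq N ≤ 8 * lam ^ 2 * (b * frobSq M) := by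
      rw [hNdef, frobSq_smul, hsq]
      refine mul_le_mul_of_nonneg_left ?_ (by positivity)
      have h1 := frobSq_mul_le hD (Mᵀ * (M * E))
      have h2 := frobSq_mul_le hMt (M * E)
      have h3 := frobSq_mul_le' hE zero_le_one M
      nlinarith
    calc _ ≤ 𝔼 s, Real.exp (sumSq (N *ᵥ signVec s)) := by
          refine Finset.expect_le_expect fun s _ => ?_
          set w := Mᵀ *ᵥ (M *ᵥ (sel τ * signVec s)) with hw
          have h1 : ∀ t, 4 * lam * ((M *ᵥ (sel τ * signVec s)) ⬝ᵥ (M *ᵥ (unsel τ * signVec t)))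
              = ∑ i, sgn (t i) * (4 * lam * unsel τ i * w i) := by
            intro t
            rw [Matrix.dotProduct_mulVec, ← Matrix.mulVec_transpose, ← hw, dotProduct,
              Finset.mul_sum]
            refine Finset.sum_congr rfl fun i _ => ?_
            simp only [Pi.mul_apply, signVec]; ring
          have h2 : N *ᵥ signVec s = fun i => √8 * lam * (unsel τ i * w i) := by
            have hEs : E *ᵥ signVec s = sel τ * signVec s := by
              funext i; rw [Matrix.mulVec_diagonal]; rfl
            funext i
            rw [hNdef, Matrix.smul_mulVec, ← Matrix.mulVec_mulVec, ← Matrix.mulVec_mulVec,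
              ← Matrix.mulVec_mulVec, hEs, ← hw, Pi.smul_apply, Matrix.mulVec_diagonal,
              smul_eq_mul]
          simp only [h1]
          refine (expect_exp_signSum_le _).trans (Real.exp_le_exp.2 (le_of_eq ?_))
          rw [h2, sumSq, Finset.sum_div]
          refine Finset.sum_congr rfl fun i _ => ?_
          rw [mul_pow (√8 * lam), hsq]; ring
      _ ≤ Real.exp (c * frobSq N) := hN N hNop
      _ ≤ _ := Real.exp_le_exp.2 (mul_le_mul_of_nonneg_left hNF hc)

/-- A self-improving upper bound is at most twice its additive term. -/
lemma bound_of_self_improving {p : ℝ → Prop} {a m : ℝ} (h0 : p m)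
    (hstep : ∀ c, 0 ≤ c → p c → p (a + c / 2)) (ha : 0 ≤ a) (hm : 0 ≤ m) (ε : ℝ) (hε : 0 < ε)
    (hmono : ∀ c d, c ≤ d → p c → p d) : p (2 * a + ε) := by
  have h : ∀ n : ℕ, p (2 * a + m / 2 ^ n) := by
    intro n
    induction n with
    | zero => exact hmono _ _ (by simp; linarith) h0
    | succ n ih =>
      have := hstep _ (by positivity) ih
      refine hmono _ _ (le_of_eq ?_) this
      rw [pow_succ]; field_simp; ring
  obtain ⟨n, hn⟩ := exists_pow_lt_of_lt_one (show 0 < ε / (m + 1) by positivity)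
    (show (1 / 2 : ℝ) < 1 by norm_num)
  refine hmono _ _ ?_ (h n)
  rw [lt_div_iff₀ (by positivity)] at hn
  have : m / 2 ^ n ≤ (1 / 2) ^ n * (m + 1) := by
    rw [div_pow, one_pow, div_mul_eq_mul_div, one_mul]
    gcongr; linarith
  linarith

lemma le_exp_of_forall_add_pos {x a g : ℝ} (h : ∀ ε > 0, x ≤ Real.exp ((a + ε) * g)) :
    x ≤ Real.exp (a * g) := by
  have hc : Filter.Tendsto (fun ε : ℝ => Real.exp ((a + ε) * g)) (nhdsWithin 0 (Set.Ioi 0))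
      (nhds (Real.exp (a * g))) := by
    have : Continuous fun ε : ℝ => Real.exp ((a + ε) * g) := by fun_prop
    have h2 := this.tendsto 0
    simp only [add_zero] at h2
    exact h2.mono_left nhdsWithin_le_nhds
  exact ge_of_tendsto hc (eventually_nhdsWithin_of_forall fun ε hε => h ε hε)

/-- The exponential moment of the squared norm of a Rademacher sum. -/
lemma expect_exp_sumSq_le (N : Matrix ι ι ℝ) (hN : OpSqLE N (1 / 16)) :
    𝔼 s, Real.exp (sumSq (N *ᵥ signVec s)) ≤ Real.exp (2 * frobSq N) := by
  refine le_exp_of_forall_add_pos fun ε hε => ?_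
  -- With λ = 1 and b = 1/16 the new Frobenius bound is 8/16 = 1/2 of the old one, so c improves to
  -- 1 + c/2. The trivial start is c = `Fintype.card ι`, from the operator norm being at most the
  -- Frobenius norm.
  refine (bound_of_self_improving (p := fun c => ∀ N : Matrix ι ι ℝ, OpSqLE N (1 / 16) →
    𝔼 s, Real.exp (sumSq (N *ᵥ signVec s)) ≤ Real.exp (c * frobSq N)) (a := 1)
    (m := Fintype.card ι) ?_ ?_ zero_le_one (by positivity) ε hε ?_ N hN).trans_eq (by ring_nf)
  · intro N _
    refine Finset.expect_le Finset.univ_nonempty fun s _ => Real.exp_le_exp.2 ?_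
    have := opSqLE_frobSq N (signVec s)
    rw [sumSq_signVec] at this
    linarith
  · intro c hc h N hN
    have h1 := expect_exp_chaos_step N (lam := 1) hN (by norm_num) hc
      (fun N' hN' => h N' (hN'.mono (by norm_num)))
    have h2 : ∀ s, Real.exp (sumSq (N *ᵥ signVec s))
        = Real.exp (frobSq N) * Real.exp (1 * (sumSq (N *ᵥ signVec s) - frobSq N)) := by
      intro s; rw [← Real.exp_add]; ring_nf
    simp only [h2, ← Finset.mul_expect]
    calc _ ≤ Real.exp (frobSq N) * Real.exp (c * (8 * 1 ^ 2 * (1 / 16 * frobSq N))) := by gcongr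
      _ = _ := by rw [← Real.exp_add]; ring_nf
  · intro c d hcd h N hN
    exact (h N hN).trans (Real.exp_le_exp.2 (mul_le_mul_of_nonneg_right hcd (frobSq_nonneg N)))

lemma expect_exp_mul_sumSq_sub_le (M : Matrix κ ι ℝ) {lam b : ℝ} (hM : OpSqLE M b) (hb : 0 ≤ b)
    (hlam : |lam| * b ≤ 1 / 12) :
    𝔼 s, Real.exp (lam * (sumSq (M *ᵥ signVec s) - frobSq M))
      ≤ Real.exp (16 * lam ^ 2 * b * frobSq M) := by
  refine (expect_exp_chaos_step M hM hb zero_le_two fun N hN =>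
    expect_exp_sumSq_le N (hN.mono ?_)).trans_eq (by ring_nf)
  have : lam ^ 2 * b ^ 2 = (|lam| * b) ^ 2 := by rw [mul_pow, sq_abs]
  have h0 : 0 ≤ |lam| * b := by positivity
  nlinarith

/-- The probability of an event under the uniform distribution on a finite type. -/
noncomputable def finProb {α : Type*} [Fintype α] (Q : α → Prop) : ℝ :=
  𝔼 a, Set.indicator {a | Q a} (fun _ => (1 : ℝ)) a

lemma finProb_le_expect {α : Type*} [Fintype α] {Q : α → Prop} {f : α → ℝ} (hf : ∀ a, 0 ≤ f a)
    (h : ∀ a, Q a → 1 ≤ f a) : finProb Q ≤ 𝔼 a, f a :=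
  Finset.expect_le_expect fun a _ => Set.indicator_le' (fun a ha => h a ha) (fun a _ => hf a) a

lemma finProb_mono {α : Type*} [Fintype α] {Q R : α → Prop} (h : ∀ a, Q a → R a) :
    finProb Q ≤ finProb R :=
  Finset.expect_le_expect fun a _ =>
    Set.indicator_le_indicator_of_subset (fun a ha => h a ha) (fun _ => zero_le_one) a

/-- Concentration of the norm of a Rademacher sum. -/
lemma finProb_abs_sqrt_sumSq_sub_one_le (M : Matrix κ ι ℝ) {b L : ℝ} (hF : frobSq M = 1)
    (hM : OpSqLE M b) (hb : 0 < b) (hL : 0 ≤ L) :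
    finProb (fun s : ι → Bool => 18 * √(b * L) < |√(sumSq (M *ᵥ signVec s)) - 1|)
      ≤ 2 * Real.exp (-L) := by
  set v := √(b * L) with hv
  have hv0 : 0 ≤ v := Real.sqrt_nonneg _
  have hv2 : v ^ 2 = b * L := Real.sq_sqrt (by positivity)
  set u := 17 * v + 12 * v ^ 2 with hu
  -- The choice is λ = v/b, capped at the admissible maximum 1/(12b). The linear and quadratic terms
  -- of u serve the two regimes.
  obtain ⟨lam, hlam0, hlam1, hlam2⟩ : ∃ lam : ℝ, 0 ≤ lam ∧ lam * b ≤ 1 / 12 ∧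
      16 * lam ^ 2 * b - lam * u ≤ -L := by
    have hLv : L = v ^ 2 / b := by rw [hv2]; field_simp
    rcases le_total v (1 / 12) with h | h
    · refine ⟨v / b, by positivity, by rw [div_mul_cancel₀ _ hb.ne']; exact h, ?_⟩
      have : 16 * (v / b) ^ 2 * b - v / b * u = (16 * v ^ 2 - v * u) / b := by field_simp
      rw [this, hLv, ← neg_div]
      gcongr
      nlinarith [pow_nonneg hv0 3]
    · refine ⟨1 / (12 * b), by positivity, by field_simp; norm_num, ?_⟩
      have : 16 * (1 / (12 * b)) ^ 2 * b - 1 / (12 * b) * u = (1 / 9 - u / 12) / b := by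
        field_simp; ring
      rw [this, hLv, ← neg_div]
      gcongr
      nlinarith
  have habs : ∀ x : ℝ, 0 ≤ x → 18 * v < |√x - 1| → u < |x - 1| := by
    intro x hx h
    by_contra! hcon
    rw [abs_le] at hcon
    have ha0 := Real.sqrt_nonneg x
    have ha2 := Real.sq_sqrt hx
    set a := √x
    rw [lt_abs] at h
    rcases h with h | h <;> nlinarith
  have h1 : ∀ s : ι → Bool, 18 * v < |√(sumSq (M *ᵥ signVec s)) - 1| →
      1 ≤ Real.exp (-lam * u) * (Real.exp (lam * (sumSq (M *ᵥ signVec s) - frobSq M))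
        + Real.exp (-lam * (sumSq (M *ᵥ signVec s) - frobSq M))) := by
    intro s hs
    have := habs _ (sumSq_nonneg _) hs
    rw [hF, mul_add, ← Real.exp_add, ← Real.exp_add]
    rcases lt_abs.1 this with h | h
    · have h2 : 1 ≤ Real.exp (-lam * u + lam * (sumSq (M *ᵥ signVec s) - 1)) :=
        Real.one_le_exp (by nlinarith)
      linarith [Real.exp_pos (-lam * u + -lam * (sumSq (M *ᵥ signVec s) - 1))]
    · have h2 : 1 ≤ Real.exp (-lam * u + -lam * (sumSq (M *ᵥ signVec s) - 1)) :=
        Real.one_le_exp (by nlinarith)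
      linarith [Real.exp_pos (-lam * u + lam * (sumSq (M *ᵥ signVec s) - 1))]
  refine (finProb_le_expect (fun s => by positivity) h1).trans ?_
  rw [← Finset.mul_expect, Finset.expect_add_distrib]
  have m1 := expect_exp_mul_sumSq_sub_le M (lam := lam) hM hb.le
    (by rwa [abs_of_nonneg hlam0])
  have m2 := expect_exp_mul_sumSq_sub_le M (lam := -lam) hM hb.le
    (by rwa [abs_neg, abs_of_nonneg hlam0])
  rw [neg_sq] at m2
  calc _ ≤ Real.exp (-lam * u) * (Real.exp (16 * lam ^ 2 * b * frobSq M)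
        + Real.exp (16 * lam ^ 2 * b * frobSq M)) := by gcongr
    _ = 2 * Real.exp (16 * lam ^ 2 * b - lam * u) := by
        rw [hF, ← two_mul, mul_left_comm, ← Real.exp_add]; ring_nf
    _ ≤ _ := by gcongr

end Chaos

/-! ### Randomly signed flat isometries have small ℓ⁴ norm. -/

section FourthPower

variable {ι : Type*} [Fintype ι]

/-- The square of the `ℓ⁴` norm of a vector. -/
noncomputable def lFourSq (v : ι → ℝ) : ℝ := √(∑ i, v i ^ 4)

lemma lFourSq_nonneg (v : ι → ℝ) : 0 ≤ lFourSq v := Real.sqrt_nonneg _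

lemma sum_pow_four_nonneg (v : ι → ℝ) : 0 ≤ ∑ i, v i ^ 4 :=
  Finset.sum_nonneg fun _ _ => by positivity

lemma sq_lFourSq (v : ι → ℝ) : lFourSq v ^ 2 = ∑ i, v i ^ 4 := Real.sq_sqrt (sum_pow_four_nonneg v)

lemma sumSq_mul_le (u v : ι → ℝ) : sumSq (u * v) ≤ lFourSq u * lFourSq v := by
  rw [lFourSq, lFourSq, ← Real.sqrt_mul (sum_pow_four_nonneg u)]
  refine Real.le_sqrt_of_sq_le ?_
  have := Finset.sum_mul_sq_le_sq_mul_sq Finset.univ (fun i => u i ^ 2) fun i => v i ^ 2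
  simp only [← pow_mul] at this
  simpa [sumSq, mul_pow] using this

/-- Interpolation between the supremum and the Euclidean norm. -/
lemma sum_pow_four_le {v : ι → ℝ} {m : ℝ} (h : ∀ i, v i ^ 2 ≤ m) :
    ∑ i, v i ^ 4 ≤ m * sumSq v := by
  unfold sumSq
  rw [Finset.mul_sum]
  refine Finset.sum_le_sum fun i _ => ?_
  nlinarith [h i, sq_nonneg (v i)]

/-- Isometries all of whose entries have the same absolute value. -/
structure IsFlatIsometry (H : Matrix ι ι ℝ) : Prop where
  isometry : ∀ v, sumSq (H *ᵥ v) = sumSq v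
  entry : ∀ i j, H i j ^ 2 = 1 / (Fintype.card ι : ℝ)

/-- The normalized square of the `ℓ⁴` norm of the transform of a vector. -/
noncomputable def spread (H : Matrix ι ι ℝ) (w : ι → ℝ) : ℝ :=
  √(Fintype.card ι : ℝ) * lFourSq (H *ᵥ w)

lemma spread_nonneg (H : Matrix ι ι ℝ) (w : ι → ℝ) : 0 ≤ spread H w :=
  mul_nonneg (Real.sqrt_nonneg _) (lFourSq_nonneg _)

lemma sq_spread (H : Matrix ι ι ℝ) (w : ι → ℝ) :
    spread H w ^ 2 = Fintype.card ι * ∑ j, (H *ᵥ w) j ^ 4 := by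
  rw [spread, mul_pow, sq_lFourSq, Real.sq_sqrt (by positivity)]

variable {H : Matrix ι ι ℝ}

lemma IsFlatIsometry.mulVec_sq_le (hH : IsFlatIsometry H) (x v : ι → ℝ) (j : ι) :
    (H *ᵥ (x * v)) j ^ 2 ≤ 1 / (Fintype.card ι : ℝ) * sumSq x * sumSq v := by
  have h := Finset.sum_mul_sq_le_sq_mul_sq Finset.univ (fun i => H j i * x i) v
  simp only [mul_pow, hH.entry, ← Finset.mul_sum] at h
  refine le_trans (le_of_eq ?_) h
  simp only [Matrix.mulVec, dotProduct, Pi.mul_apply, mul_assoc]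

/-- A crude bound, in terms of the support of the vector. -/
lemma IsFlatIsometry.sq_spread_le [Nonempty ι] (hH : IsFlatIsometry H) {w a : ι → ℝ}
    (ha : a * w = w) (hw : sumSq w ≤ 1) : spread H w ^ 2 ≤ sumSq a := by
  have hd : (0 : ℝ) < Fintype.card ι := by exact_mod_cast Fintype.card_pos
  have h1 : ∀ j, (H *ᵥ w) j ^ 2 ≤ 1 / (Fintype.card ι : ℝ) * sumSq a := by
    intro j
    have := hH.mulVec_sq_le a w j
    rw [ha] at this
    refine this.trans (mul_le_of_le_one_right ?_ hw)
    exact mul_nonneg (by positivity) (sumSq_nonneg a)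
  have h2 := sum_pow_four_le h1
  rw [hH.isometry] at h2
  rw [sq_spread]
  calc _ ≤ (Fintype.card ι : ℝ) * (1 / Fintype.card ι * sumSq a * sumSq w) := by gcongr
    _ = sumSq a * sumSq w := by field_simp
    _ ≤ sumSq a := mul_le_of_le_one_right (sumSq_nonneg a) hw

variable [DecidableEq ι]

/-- `lFourSq` of a vector is the ℓ² norm of its vector of squared coordinates. Decoupling each
coordinate splits that vector into a constant part, which contributes at most 1, and an average of
products, to which the triangle inequality in ℓ² applies. -/
lemma spread_le_expect_decoupled (H : Matrix ι ι ℝ) (hH : IsFlatIsometry H) [Nonempty ι]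
    (x : ι → ℝ) (hx : sumSq x ≤ 1) (s : ι → Bool) :
    spread H (x * signVec s) ≤ 𝔼 τ : ι → Bool, (1 + 4 * √(Fintype.card ι *
      sumSq ((H *ᵥ (x * (sel τ * signVec s))) * (H *ᵥ (x * (unsel τ * signVec s)))))) := by
  have hd : (0 : ℝ) < Fintype.card ι := by exact_mod_cast Fintype.card_pos
  have hrow : ∀ j, (H *ᵥ (x * signVec s)) j ^ 2 = sumSq x / Fintype.card ι
      + 4 * 𝔼 τ : ι → Bool, (H *ᵥ (x * (sel τ * signVec s))) j
        * (H *ᵥ (x * (unsel τ * signVec s))) j := by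
    intro j
    have := sq_sum_decouple fun i => H j i * (x i * signVec s i)
    simp only [mul_pow, signVec, sgn_sq, mul_one, hH.entry, ← Finset.mul_sum] at this
    simp only [Matrix.mulVec, dotProduct, signVec, Pi.mul_apply]
    rw [this, sumSq, div_mul_eq_mul_div, one_mul]
    congr 2
    refine Finset.expect_congr rfl fun τ _ => ?_
    congr 1 <;> exact Finset.sum_congr rfl fun i _ => by ring
  let c : EuclideanSpace ℝ ι := WithLp.toLp 2 fun _ => sumSq x / Fintype.card ι
  let g : (ι → Bool) → EuclideanSpace ℝ ι := fun τ => WithLp.toLp 2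
    ((H *ᵥ (x * (sel τ * signVec s))) * (H *ᵥ (x * (unsel τ * signVec s))))
  have hg : ∀ τ, ‖g τ‖ = √(sumSq ((H *ᵥ (x * (sel τ * signVec s)))
      * (H *ᵥ (x * (unsel τ * signVec s))))) := by
    intro τ
    simp only [EuclideanSpace.norm_eq, g, sumSq, Real.norm_eq_abs, sq_abs]
  have hc : ‖c‖ ≤ 1 / √(Fintype.card ι : ℝ) := by
    rw [EuclideanSpace.norm_eq]
    simp only [c, Real.norm_eq_abs, sq_abs, Finset.sum_const, Finset.card_univ, nsmul_eq_mul]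
    rw [div_pow, ← Real.sqrt_one, ← Real.sqrt_div zero_le_one]
    refine Real.sqrt_le_sqrt ?_
    have : sumSq x ^ 2 ≤ 1 := pow_le_one₀ (sumSq_nonneg x) hx
    calc _ = sumSq x ^ 2 / Fintype.card ι := by field_simp
      _ ≤ _ := by gcongr
  set m : ℝ := (Fintype.card (ι → Bool) : ℝ)⁻¹ with hm
  have hE : ∀ f : (ι → Bool) → ℝ, 𝔼 τ, f τ = m * ∑ τ, f τ := fun f => by
    rw [Fintype.expect_eq_sum_div_card, div_eq_inv_mul]
  have hq : lFourSq (H *ᵥ (x * signVec s)) = ‖c + (4 * m) • ∑ τ, g τ‖ := by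
    rw [EuclideanSpace.norm_eq, lFourSq]
    congr 1
    refine Finset.sum_congr rfl fun j _ => ?_
    rw [show (4 : ℕ) = 2 * 2 from rfl, pow_mul, hrow j, Real.norm_eq_abs, sq_abs, hE, ← mul_assoc]
    simp [c, g]
  have htri : lFourSq (H *ᵥ (x * signVec s)) ≤ 1 / √(Fintype.card ι : ℝ) + 4 * 𝔼 τ, ‖g τ‖ := by
    rw [hq, hE, ← mul_assoc]
    refine (norm_add_le _ _).trans (add_le_add hc ?_)
    rw [norm_smul, Real.norm_of_nonneg (by positivity)]
    gcongr
    exact norm_sum_le _ _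
  rw [Finset.expect_add_distrib, ← Finset.mul_expect, Fintype.expect_const, spread]
  calc _ ≤ √(Fintype.card ι : ℝ) * (1 / √(Fintype.card ι : ℝ) + 4 * 𝔼 τ, ‖g τ‖) := by gcongr
    _ = 1 + 4 * 𝔼 τ, √(Fintype.card ι : ℝ) * ‖g τ‖ := by
        rw [← Finset.mul_expect, mul_add, mul_one_div_cancel (Real.sqrt_pos.2 hd).ne']; ring
    _ = _ := by simp only [hg, ← Real.sqrt_mul hd.le]

/-- The exponential moment of the transform of a Rademacher sum, multiplied by a fixed vector. -/
lemma expect_exp_decoupled_le (hH : IsFlatIsometry H) [Nonempty ι] {x u : ι → ℝ} {T lam : ℝ}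
    (hT : 1 ≤ T) (hlam : lam = √T / 128) (hx : sumSq x ≤ 1) (hxT : ∀ i, x i ^ 2 ≤ 1 / T)
    (hu : sumSq u ≤ 1) :
    𝔼 t, Real.exp (4 * lam * √(Fintype.card ι * sumSq ((H *ᵥ u) * (H *ᵥ (x * signVec t)))))
      ≤ Real.exp (6 * lam + lam * spread H u / 2) := by
  have hd : (0 : ℝ) < Fintype.card ι := by exact_mod_cast Fintype.card_pos
  have hTs : 0 < √T := Real.sqrt_pos.2 (by linarith)
  have hl0 : 0 < lam := by rw [hlam]; positivity
  have hq0 := spread_nonneg H u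
  set q := spread H u with hq
  -- With μ = 1/ρ, the first summand forces 16μq/√T ≤ 1, as the operator norm bound 1/16 requires;
  -- the second forces μ ≤ λ, which bounds the Frobenius cost.
  set ρ := 16 * q / √T + 1 / lam with hρ
  have hρ0 : 0 < ρ := by positivity
  set mu := 1 / ρ with hmu
  have hmu0 : 0 < mu := by positivity
  set N : Matrix ι ι ℝ := √(mu * Fintype.card ι) •
    (Matrix.diagonal (H *ᵥ u) * (H * Matrix.diagonal x)) with hN
  have hNv : ∀ v, N *ᵥ v = √(mu * Fintype.card ι) • ((H *ᵥ u) * (H *ᵥ (x * v))) := by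
    intro v
    have : Matrix.diagonal x *ᵥ v = x * v := by funext i; rw [Matrix.mulVec_diagonal]; rfl
    rw [hN, Matrix.smul_mulVec, ← Matrix.mulVec_mulVec, ← Matrix.mulVec_mulVec, this]
    congr 1
    funext i
    rw [Matrix.mulVec_diagonal]; rfl
  have hsq : √(mu * Fintype.card ι) ^ 2 = mu * Fintype.card ι := Real.sq_sqrt (by positivity)
  have hNs : ∀ v, sumSq (N *ᵥ v)
      = mu * (Fintype.card ι * sumSq ((H *ᵥ u) * (H *ᵥ (x * v)))) := by
    intro v; rw [hNv, sumSq_smul, hsq, mul_assoc]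
  have hfour : ∀ v, lFourSq (H *ᵥ (x * v)) ≤ 1 / (√(Fintype.card ι : ℝ) * √T) * sumSq v := by
    intro v
    have h1 : ∀ j, (H *ᵥ (x * v)) j ^ 2 ≤ 1 / (Fintype.card ι : ℝ) * sumSq v := fun j => by
      refine (hH.mulVec_sq_le x v j).trans ?_
      refine mul_le_mul_of_nonneg_right ?_ (sumSq_nonneg v)
      exact mul_le_of_le_one_right (by positivity) hx
    have h2 := sum_pow_four_le h1
    rw [hH.isometry] at h2
    have h3 : sumSq (x * v) ≤ 1 / T * sumSq v := by
      unfold sumSq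
      rw [Finset.mul_sum]
      refine Finset.sum_le_sum fun i _ => ?_
      rw [Pi.mul_apply, mul_pow]
      exact mul_le_mul_of_nonneg_right (hxT i) (sq_nonneg _)
    have hv := sumSq_nonneg v
    rw [lFourSq]
    refine Real.sqrt_le_iff.2 ⟨by positivity, h2.trans ?_⟩
    calc _ ≤ 1 / (Fintype.card ι : ℝ) * sumSq v * (1 / T * sumSq v) := by gcongr
      _ = _ := by
        rw [mul_pow, div_pow, mul_pow, Real.sq_sqrt hd.le, Real.sq_sqrt (by linarith)]
        field_simp
  have hNop : OpSqLE N (1 / 16) := by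
    intro v
    have hv := sumSq_nonneg v
    rw [hNs]
    calc _ ≤ mu * (Fintype.card ι * (lFourSq (H *ᵥ u)
            * (1 / (√(Fintype.card ι : ℝ) * √T) * sumSq v))) := by
          gcongr
          exact (sumSq_mul_le _ _).trans
            (mul_le_mul_of_nonneg_left (hfour v) (lFourSq_nonneg _))
      _ = mu * (q / √T) * sumSq v := by
          rw [hq, spread]
          have := Real.sq_sqrt hd.le
          have h0 := (Real.sqrt_pos.2 hd).ne'
          field_simp
          rw [this]
          ring
      _ ≤ _ := by
          gcongr
          rw [hmu, one_div, inv_mul_le_iff₀ hρ0, hρ, mul_one_div]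
          have : 0 < 1 / lam := by positivity
          rw [mul_div_assoc]
          linarith
  have hNF : frobSq N ≤ mu := by
    rw [hN, frobSq_smul, hsq]
    have : frobSq (Matrix.diagonal (H *ᵥ u) * (H * Matrix.diagonal x))
        = 1 / Fintype.card ι * (sumSq (H *ᵥ u) * sumSq x) := by
      unfold frobSq sumSq
      rw [Finset.sum_mul_sum, Finset.mul_sum]
      refine Finset.sum_congr rfl fun j _ => ?_
      rw [Finset.mul_sum]
      refine Finset.sum_congr rfl fun i _ => ?_
      rw [Matrix.diagonal_mul, Matrix.mul_diagonal, mul_pow, mul_pow, hH.entry]; ring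
    rw [this, hH.isometry]
    have h1 : sumSq u * sumSq x ≤ 1 := mul_le_one₀ hu (sumSq_nonneg x) hx
    calc _ = mu * (sumSq u * sumSq x) := by field_simp
      _ ≤ mu := mul_le_of_le_one_right hmu0.le h1
  have hmul : mu ≤ lam := by
    rw [hmu, one_div_le hρ0 hl0, hρ]
    have : 0 ≤ 16 * q / √T := by positivity
    linarith
  -- The square root is linearised by 4λ√X ≤ μX + 4λ²/μ, so that only a squared norm remains to be
  -- integrated.
  have hlin : ∀ t, 4 * lam * √(Fintype.card ι * sumSq ((H *ᵥ u) * (H *ᵥ (x * signVec t))))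
      ≤ sumSq (N *ᵥ signVec t) + 4 * lam ^ 2 * ρ := by
    intro t
    rw [hNs]
    set X := Fintype.card ι * sumSq ((H *ᵥ u) * (H *ᵥ (x * signVec t))) with hX
    have hX0 : 0 ≤ X := mul_nonneg hd.le (sumSq_nonneg _)
    have h1 := Real.sq_sqrt hX0
    have h2 : mu * X + 4 * lam ^ 2 * ρ - 4 * lam * √X = mu * (√X - 2 * lam * ρ) ^ 2 := by
      rw [sub_sq, h1, hmu]; field_simp; ring
    have h3 : 0 ≤ mu * (√X - 2 * lam * ρ) ^ 2 := by positivity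
    linarith
  have hρl : 4 * lam ^ 2 * ρ = lam * q / 2 + 4 * lam := by
    have : lam ^ 2 * (16 * q / √T) = lam * q / 8 := by rw [hlam]; field_simp; ring
    rw [hρ, mul_add, mul_assoc 4, this]
    field_simp
    ring
  calc _ ≤ 𝔼 t, Real.exp (4 * lam ^ 2 * ρ) * Real.exp (sumSq (N *ᵥ signVec t)) := by
        refine Finset.expect_le_expect fun t _ => ?_
        rw [← Real.exp_add]
        exact Real.exp_le_exp.2 (by linarith [hlin t])
    _ ≤ Real.exp (4 * lam ^ 2 * ρ) * Real.exp (2 * frobSq N) := by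
        rw [← Finset.mul_expect]
        gcongr
        exact expect_exp_sumSq_le N hNop
    _ ≤ _ := by
        rw [← Real.exp_add, hρl]
        exact Real.exp_le_exp.2 (by linarith)

lemma sumSq_mul_le_of_sq_le_one {κ : Type*} [Fintype κ] {a v : κ → ℝ} (ha : ∀ i, a i ^ 2 ≤ 1) :
    sumSq (a * v) ≤ sumSq v :=
  Finset.sum_le_sum fun i _ => by
    rw [Pi.mul_apply, mul_pow]; exact mul_le_of_le_one_left (sq_nonneg _) (ha i)

/-- Conditionally on one half of the signs, `expect_exp_decoupled_le` returns the same quantity with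
λ halved, so an exponent c improves to 7λ + c/2. -/
lemma expect_exp_spread_le (hH : IsFlatIsometry H) [Nonempty ι] {x : ι → ℝ} {T lam : ℝ}
    (hT : 1 ≤ T) (hlam : lam = √T / 128) (hx : sumSq x ≤ 1) (hxT : ∀ i, x i ^ 2 ≤ 1 / T) :
    𝔼 s, Real.exp (lam * spread H (x * signVec s)) ≤ Real.exp (14 * lam) := by
  have hd : (0 : ℝ) < Fintype.card ι := by exact_mod_cast Fintype.card_pos
  have hl0 : 0 < lam := by rw [hlam]; positivity
  suffices h : ∀ ε > 0, 𝔼 s, Real.exp (lam * spread H (x * signVec s))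
      ≤ Real.exp ((14 * lam + ε) * 1) by
    simpa using le_exp_of_forall_add_pos h
  intro ε hε
  -- The bootstrap treats all admissible vectors at once, since each step passes from x to a
  -- restriction of x.
  refine (bound_of_self_improving (p := fun c => ∀ x : ι → ℝ, sumSq x ≤ 1 →
    (∀ i, x i ^ 2 ≤ 1 / T) → 𝔼 s, Real.exp (lam * spread H (x * signVec s)) ≤ Real.exp c)
    (a := 7 * lam) (m := lam * Fintype.card ι) ?_ ?_ (by positivity) (by positivity) ε hε
    ?_ x hx hxT).trans_eq (by ring_nf)
  · intro x hx _
    refine Finset.expect_le Finset.univ_nonempty fun s _ => Real.exp_le_exp.2 ?_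
    gcongr
    have hw : sumSq (x * signVec s) ≤ 1 := by
      rw [mul_comm]
      exact (sumSq_mul_le_of_sq_le_one fun i => (sgn_sq _).le).trans hx
    have h1 := hH.sq_spread_le (a := 1) (one_mul _) hw
    have h2 : sumSq (1 : ι → ℝ) = Fintype.card ι := by simp [sumSq]
    have h3 : (1 : ℝ) ≤ Fintype.card ι := by exact_mod_cast Fintype.card_pos
    rw [h2] at h1
    exact abs_le_of_sq_le_sq' (by nlinarith) hd.le |>.2
  · intro c hc h x hx hxT
    refine expect_exp_le_of_decoupled _
      (fun _ u v => lam * (1 + 4 * √(Fintype.card ι * sumSq ((H *ᵥ (x * u)) * (H *ᵥ (x * v))))))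
      _ (fun s => ?_) fun τ => ?_
    · rw [← Finset.mul_expect]
      exact mul_le_mul_of_nonneg_left (spread_le_expect_decoupled H hH x hx s) hl0.le
    · set y := sel τ * x with hy
      set z := unsel τ * x with hz
      have hy1 : sumSq y ≤ 1 := (sumSq_mul_le_of_sq_le_one (sel_sq_le τ)).trans hx
      have hz1 : sumSq z ≤ 1 := (sumSq_mul_le_of_sq_le_one (unsel_sq_le τ)).trans hx
      have hyT : ∀ i, y i ^ 2 ≤ 1 / T := fun i => by
        rw [hy, Pi.mul_apply, mul_pow]
        exact (mul_le_of_le_one_left (sq_nonneg _) (sel_sq_le τ i)).trans (hxT i)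
      have hzT : ∀ i, z i ^ 2 ≤ 1 / T := fun i => by
        rw [hz, Pi.mul_apply, mul_pow]
        exact (mul_le_of_le_one_left (sq_nonneg _) (unsel_sq_le τ i)).trans (hxT i)
      have e1 : ∀ s, x * (sel τ * signVec s) = y * signVec s := fun s => by rw [hy]; ring
      have e2 : ∀ s, x * (unsel τ * signVec s) = z * signVec s := fun s => by rw [hz]; ring
      simp only [e1, e2]
      calc _ ≤ 𝔼 s, Real.exp (7 * lam + lam * spread H (y * signVec s) / 2) := by
            refine Finset.expect_le_expect fun s _ => ?_
            have hu : sumSq (y * signVec s) ≤ 1 := by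
              rw [mul_comm]
              exact (sumSq_mul_le_of_sq_le_one fun i => (sgn_sq _).le).trans hy1
            have := expect_exp_decoupled_le hH hT hlam hz1 hzT hu
            have e3 : ∀ X : ℝ, Real.exp (lam * (1 + 4 * X))
                = Real.exp lam * Real.exp (4 * lam * X) := fun X => by
              rw [← Real.exp_add]; ring_nf
            simp only [e3, ← Finset.mul_expect]
            refine (mul_le_mul_of_nonneg_left this (Real.exp_pos lam).le).trans_eq ?_
            rw [← Real.exp_add]; ring_nf
        -- The arithmetic-geometric mean inequality, balanced by c, turns the half exponent into a
        -- full one.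
        _ ≤ 𝔼 s, Real.exp (7 * lam) * ((Real.exp (-(c / 2))
              * Real.exp (lam * spread H (y * signVec s)) + Real.exp (c / 2)) / 2) := by
            refine Finset.expect_le_expect fun s _ => ?_
            rw [Real.exp_add]
            gcongr
            set A := lam * spread H (y * signVec s)
            have h1 := two_mul_le_add_sq (Real.exp (-(c / 4) + A / 2)) (Real.exp (c / 4))
            rw [← Real.exp_nat_mul, ← Real.exp_nat_mul, mul_assoc, ← Real.exp_add] at h1
            rw [← Real.exp_add]
            have g1 : -(c / 4) + A / 2 + c / 4 = A / 2 := by ring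
            have g2 : ((2 : ℕ) : ℝ) * (-(c / 4) + A / 2) = -(c / 2) + A := by push_cast; ring
            have g3 : ((2 : ℕ) : ℝ) * (c / 4) = c / 2 := by push_cast; ring
            rw [g1, g2, g3] at h1
            linarith
        _ ≤ Real.exp (7 * lam) * ((Real.exp (-(c / 2)) * Real.exp c + Real.exp (c / 2)) / 2) := by
            rw [← Finset.mul_expect, ← Finset.expect_div, Finset.expect_add_distrib,
              ← Finset.mul_expect, Fintype.expect_const]
            gcongr
            exact h y hy1 hyT
        _ = _ := by
            rw [← Real.exp_add, show -(c / 2) + c = c / 2 by ring, add_self_div_two,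
              ← Real.exp_add]
  · intro c d hcd h x hx hxT
    exact (h x hx hxT).trans (Real.exp_le_exp.2 hcd)

/-- Tail bound for the fourth powers of the coordinates of a randomly signed transform. -/
lemma finProb_spread_le (hH : IsFlatIsometry H) [Nonempty ι] {x : ι → ℝ} {T : ℝ}
    (hT : 1 ≤ T) (hx : sumSq x ≤ 1) :
    finProb (fun s : ι → Bool => 402 * √T < spread H (x * signVec s)) ≤ Real.exp (-T) := by
  have hd : (0 : ℝ) < Fintype.card ι := by exact_mod_cast Fintype.card_pos
  have hT1 : 1 ≤ √T := Real.one_le_sqrt.2 hT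
  have hT2 : √T ^ 2 = T := Real.sq_sqrt (by linarith)
  set lam := √T / 128 with hlam
  have hl0 : 0 < lam := by positivity
  -- There are at most T coordinates with x_i² > 1/T, so the crude support bound handles them; the
  -- rest satisfy the hypothesis of the moment bound.
  set a : ι → ℝ := fun i => if 1 / T < x i ^ 2 then 1 else 0 with ha
  set y := a * x with hy
  set z := (1 - a) * x with hz
  have ha1 : ∀ i, a i ^ 2 ≤ 1 := fun i => by simp only [ha]; split_ifs <;> norm_num
  have ha2 : ∀ i, (1 - a) i ^ 2 ≤ 1 := fun i => by
    simp only [ha, Pi.sub_apply, Pi.one_apply]; split_ifs <;> norm_num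
  have hz1 : sumSq z ≤ 1 := (sumSq_mul_le_of_sq_le_one ha2).trans hx
  have hy1 : sumSq y ≤ 1 := (sumSq_mul_le_of_sq_le_one ha1).trans hx
  have hzT : ∀ i, z i ^ 2 ≤ 1 / T := fun i => by
    simp only [hz, ha, Pi.mul_apply, Pi.sub_apply, Pi.one_apply]
    split_ifs with h
    · simp; linarith
    · simpa using h
  have hasq : sumSq a ≤ T := by
    have h1 : ∀ i, a i ^ 2 ≤ T * x i ^ 2 := fun i => by
      simp only [ha]
      split_ifs with h
      · rw [div_lt_iff₀ (by linarith)] at h; linarith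
      · simp; positivity
    calc sumSq a ≤ ∑ i, T * x i ^ 2 := Finset.sum_le_sum fun i _ => h1 i
      _ = T * sumSq x := by rw [sumSq, Finset.mul_sum]
      _ ≤ T := mul_le_of_le_one_right (by linarith) hx
  have hlarge : ∀ s, spread H (y * signVec s) ^ 2 ≤ T := by
    intro s
    refine (hH.sq_spread_le (a := a) ?_ ?_).trans hasq
    · rw [hy, ← mul_assoc, ← mul_assoc]
      congr 2
      funext i
      simp only [ha, Pi.mul_apply]; split_ifs <;> simp
    · rw [mul_comm]
      exact (sumSq_mul_le_of_sq_le_one fun i => (sgn_sq _).le).trans hy1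
  have hsplit : ∀ s, spread H (x * signVec s) ^ 2
      ≤ 8 * spread H (y * signVec s) ^ 2 + 8 * spread H (z * signVec s) ^ 2 := by
    intro s
    have h1 : x * signVec s = y * signVec s + z * signVec s := by rw [hy, hz]; ring
    rw [sq_spread, sq_spread, sq_spread, h1, Matrix.mulVec_add]
    rw [mul_left_comm 8, mul_left_comm 8, ← mul_add, Finset.mul_sum (a := 8), Finset.mul_sum (a := 8),
      ← Finset.sum_add_distrib]
    gcongr with j
    rw [Pi.add_apply]
    set p := (H *ᵥ (y * signVec s)) j
    set q := (H *ᵥ (z * signVec s)) j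
    have h2 : (p + q) ^ 2 ≤ 2 * (p ^ 2 + q ^ 2) := by nlinarith [sq_nonneg (p - q)]
    have h3 : ((p + q) ^ 2) ^ 2 ≤ (2 * (p ^ 2 + q ^ 2)) ^ 2 := by gcongr
    nlinarith [sq_nonneg (p ^ 2 - q ^ 2)]
  have hbad : ∀ s, 402 * √T < spread H (x * signVec s) → 142 * √T < spread H (z * signVec s) := by
    intro s hs
    by_contra! hcon
    have h1 := spread_nonneg H (z * signVec s)
    have h2 : spread H (z * signVec s) ^ 2 ≤ (142 * √T) ^ 2 := by gcongr
    have h3 : (402 * √T) ^ 2 < spread H (x * signVec s) ^ 2 := by gcongr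
    have := hsplit s
    have := hlarge s
    rw [mul_pow, hT2] at h2 h3
    linarith
  refine (finProb_le_expect (f := fun s => Real.exp (-(142 * √T * lam))
    * Real.exp (lam * spread H (z * signVec s))) (fun s => by positivity) fun s hs => ?_).trans ?_
  · rw [← Real.exp_add]
    refine Real.one_le_exp ?_
    have := hbad s hs
    nlinarith
  · rw [← Finset.mul_expect]
    calc _ ≤ Real.exp (-(142 * √T * lam)) * Real.exp (14 * lam) := by
          gcongr
          exact expect_exp_spread_le hH hT hlam hz1 hzT
      _ ≤ _ := by
          rw [← Real.exp_add, hlam]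
          refine Real.exp_le_exp.2 ?_
          nlinarith

end FourthPower

/-! ### Four-wise independent code matrices. -/

section CodeMatrix

/-- Flip the signs of a sign vector where `c` is true. -/
def xorSign {α : Type*} (c : α → Bool) : (α → Bool) ≃ (α → Bool) where
  toFun s i := xor (s i) (c i)
  invFun s i := xor (s i) (c i)
  left_inv s := by funext i; simp
  right_inv s := by funext i; simp

/-- The marginals of the uniform distribution on sign vectors are uniform. -/
lemma expect_comp_injective {α β : Type*} [Fintype α] [Fintype β] [DecidableEq α] [DecidableEq β]
    {i : α → β} (hi : Function.Injective i) (g : (α → Bool) → ℝ) :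
    𝔼 s : β → Bool, g (s ∘ i) = 𝔼 b, g b := by
  have h1 : ∀ b : α → Bool, 𝔼 s : β → Bool, g (s ∘ i)
      = 𝔼 s : β → Bool, g (xorSign (s ∘ i) b) := by
    intro b
    refine (Fintype.expect_equiv (xorSign (Function.extend i b fun _ => false)) _ _ ?_).symm
    intro s
    congr 1
    funext a
    simp [xorSign, hi.extend_apply, Bool.xor_comm]
  have h2 : ∀ s : β → Bool, 𝔼 b : α → Bool, g (xorSign (s ∘ i) b) = 𝔼 b, g b :=
    fun s => Fintype.expect_equiv (xorSign (s ∘ i)) _ _ fun _ => rfl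
  calc _ = 𝔼 b : α → Bool, 𝔼 s : β → Bool, g (s ∘ i) := (Fintype.expect_const _).symm
    _ = 𝔼 b : α → Bool, 𝔼 s : β → Bool, g (xorSign (s ∘ i) b) :=
        Finset.expect_congr rfl fun b _ => h1 b
    _ = 𝔼 s : β → Bool, 𝔼 b : α → Bool, g (xorSign (s ∘ i) b) := Finset.expect_comm _ _ _
    _ = 𝔼 s : β → Bool, 𝔼 b, g b := Finset.expect_congr rfl fun s _ => h2 s
    _ = _ := Fintype.expect_const _

/-- Fourth powers expand into products over row indices that may repeat, whereas four-wise
independence speaks only of increasing rows. -/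
lemma exists_strictMono_factor {k : ℕ} (hk : 4 ≤ k) (r : Fin 4 → Fin k) :
    ∃ (i : Fin 4 → Fin k) (π : Fin 4 → Fin 4), StrictMono i ∧ r = i ∘ π := by
  obtain ⟨t, hrt, ht⟩ := Finset.exists_superset_card_eq (s := Finset.univ.image r) (n := 4)
    (Finset.card_image_le.trans (by simp)) (by simpa using hk)
  refine ⟨t.orderEmbOfFin ht, fun a => (t.orderIsoOfFin ht).symm
    ⟨r a, hrt (Finset.mem_image_of_mem r (Finset.mem_univ a))⟩, (t.orderEmbOfFin ht).strictMono, ?_⟩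
  funext a
  simp [← Finset.coe_orderIsoOfFin_apply]

lemma sgn_injective : Function.Injective sgn := by
  intro a b h
  cases a <;> cases b <;> first | rfl | norm_num [sgn] at h

variable {k d : ℕ} {B : Matrix (Fin k) (Fin d) ℝ}

lemma IsFourWiseIndependent.exists_sign (hB : IsFourWiseIndependent B) :
    ∃ β : Fin k → Fin d → Bool, ∀ i j, B i j = sgn (β i j) / √(k : ℝ) := by
  have h : ∀ i j, ∃ b, B i j = sgn b / √(k : ℝ) := fun i j => by
    rcases hB.entry i j with h | h
    · exact ⟨true, by simpa [sgn] using h⟩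
    · exact ⟨false, by simpa [sgn] using h⟩
  choose β hβ using h
  exact ⟨β, hβ⟩

/-- On four increasing rows a uniformly random column is a scaled uniform sign vector, so mixed
fourth moments over the columns are Rademacher moments. -/
lemma IsFourWiseIndependent.sum_prod_eq (hB : IsFourWiseIndependent B) (hk : 4 ≤ k)
    (r : Fin 4 → Fin k) :
    ∑ j, ∏ a, B (r a) j = d / (k : ℝ) ^ 2 * 𝔼 s : Fin k → Bool, ∏ a, sgn (s (r a)) := by
  obtain ⟨i, π, hi, rfl⟩ := exists_strictMono_factor hk r
  obtain ⟨β, hβ⟩ := hB.exists_sign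
  have hk0 : (0 : ℝ) < k := by exact_mod_cast (by omega : 0 < k)
  have hk4 : √(k : ℝ) ^ 4 = (k : ℝ) ^ 2 := by
    rw [show 4 = 2 * 2 from rfl, pow_mul, Real.sq_sqrt hk0.le]
  have hks : √(k : ℝ) ≠ 0 := (Real.sqrt_pos.2 hk0).ne'
  have h1 : ∀ j, ∏ a, B ((i ∘ π) a) j = (∏ a, sgn (β (i (π a)) j)) / (k : ℝ) ^ 2 := by
    intro j
    simp only [hβ, Finset.prod_div_distrib, Finset.prod_const, Finset.card_univ,
      Fintype.card_fin, hk4, Function.comp]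
  have hcard : ∀ b : Fin 4 → Bool,
      16 * (Finset.univ.filter fun j => (fun a => β (i a) j) = b).card = d := by
    intro b
    have := hB.pattern i hi (fun a => sgn (b a)) fun a => by cases b a <;> simp [sgn]
    refine Eq.trans ?_ this
    rw [← Set.ncard_coe_finset]
    congr 2
    ext j
    simp only [Finset.coe_filter, Finset.mem_univ, true_and, Set.mem_ofPred_eq, hβ, funext_iff]
    refine forall_congr' fun a => ?_
    rw [div_left_inj' hks, sgn_injective.eq_iff]
  have h2 : 𝔼 s : Fin k → Bool, ∏ a, sgn (s ((i ∘ π) a)) = 𝔼 b : Fin 4 → Bool, ∏ a, sgn (b (π a)) :=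
    expect_comp_injective hi.injective fun b => ∏ a, sgn (b (π a))
  simp only [h1]
  rw [← Finset.sum_div, h2, ← Finset.sum_fiberwise Finset.univ (fun j a => β (i a) j),
    Fintype.expect_eq_sum_div_card]
  have h3 : ∀ b : Fin 4 → Bool,
      ∑ j with (fun a => β (i a) j) = b, ∏ a, sgn (β (i (π a)) j)
        = (d : ℝ) / 16 * ∏ a, sgn (b (π a)) := by
    intro b
    have hc : (((Finset.univ.filter fun j => (fun a => β (i a) j) = b).card : ℕ) : ℝ)
        = (d : ℝ) / 16 := by
      rw [eq_div_iff (by norm_num), mul_comm]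
      exact_mod_cast hcard b
    rw [← hc, ← nsmul_eq_mul, ← Finset.sum_const]
    refine Finset.sum_congr rfl fun j hj => ?_
    rw [Finset.mem_filter] at hj
    rw [← hj.2]
  simp only [h3, ← Finset.mul_sum, Fintype.card_fun, Fintype.card_bool, Fintype.card_fin]
  push_cast
  ring

/-- The transpose of a four-wise independent code matrix, as an operator from `ℓ²` to `ℓ⁴`. -/
lemma IsFourWiseIndependent.lFourSq_transpose_mulVec_le (hB : IsFourWiseIndependent B)
    (hk : 4 ≤ k) (u : Fin k → ℝ) : lFourSq (Bᵀ *ᵥ u) ≤ 9 / k * √(d : ℝ) * sumSq u := by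
  have hk0 : (0 : ℝ) < k := by exact_mod_cast (by omega : 0 < k)
  have h1 : ∑ j, (Bᵀ *ᵥ u) j ^ 4
      = d / (k : ℝ) ^ 2 * 𝔼 s : Fin k → Bool, (∑ i, sgn (s i) * u i) ^ 4 := by
    simp only [Matrix.mulVec, dotProduct, Matrix.transpose_apply, Fintype.sum_pow,
      Finset.prod_mul_distrib, Finset.expect_sum_comm, ← Finset.expect_mul]
    rw [Finset.sum_comm, Finset.mul_sum]
    refine Finset.sum_congr rfl fun r _ => ?_
    rw [← Finset.sum_mul, hB.sum_prod_eq hk r, mul_assoc]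
  have h2 := expect_signSum_pow_four_le u
  have hs := sumSq_nonneg u
  rw [lFourSq, h1]
  refine Real.sqrt_le_iff.2 ⟨by positivity, ?_⟩
  calc _ ≤ d / (k : ℝ) ^ 2 * (80 * sumSq u ^ 2) := by gcongr; exact h2
    _ ≤ d / (k : ℝ) ^ 2 * (81 * sumSq u ^ 2) := by gcongr; norm_num
    _ = _ := by rw [mul_pow, mul_pow, Real.sq_sqrt (by positivity)]; ring

/-- Pass to the transpose u ↦ y · Bᵀu and apply Cauchy–Schwarz to the squared coordinates. -/
lemma IsFourWiseIndependent.opSqLE_mul_diagonal (hB : IsFourWiseIndependent B) (hk : 4 ≤ k)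
    (y : Fin d → ℝ) : OpSqLE (B * Matrix.diagonal y) (9 / k * √(d : ℝ) * lFourSq y) := by
  have hk0 : (0 : ℝ) < k := by exact_mod_cast (by omega : 0 < k)
  have hy := lFourSq_nonneg y
  have h : OpSqLE (B * Matrix.diagonal y)ᵀ (9 / k * √(d : ℝ) * lFourSq y) := by
    intro u
    have : (B * Matrix.diagonal y)ᵀ *ᵥ u = y * (Bᵀ *ᵥ u) := by
      rw [Matrix.transpose_mul, Matrix.diagonal_transpose, ← Matrix.mulVec_mulVec]
      funext j
      rw [Matrix.mulVec_diagonal]; rfl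
    rw [this]
    calc _ ≤ lFourSq y * lFourSq (Bᵀ *ᵥ u) := sumSq_mul_le _ _
      _ ≤ lFourSq y * (9 / k * √(d : ℝ) * sumSq u) := by
          gcongr; exact hB.lFourSq_transpose_mulVec_le hk u
      _ = _ := by ring
  simpa using h.transpose (by positivity)

lemma IsFourWiseIndependent.frobSq_mul_diagonal (hB : IsFourWiseIndependent B) (hk : 0 < k)
    (y : Fin d → ℝ) : frobSq (B * Matrix.diagonal y) = sumSq y := by
  have hk0 : (0 : ℝ) < k := by exact_mod_cast hk
  obtain ⟨β, hβ⟩ := hB.exists_sign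
  have h : ∀ i j, (B * Matrix.diagonal y) i j ^ 2 = 1 / k * y j ^ 2 := by
    intro i j
    rw [Matrix.mul_diagonal, mul_pow, hβ, div_pow, sgn_sq, Real.sq_sqrt hk0.le]
  simp only [frobSq, sumSq, h, ← Finset.mul_sum, Finset.sum_const, Finset.card_univ,
    Fintype.card_fin, nsmul_eq_mul]
  field_simp

end CodeMatrix

/-! ### The Walsh–Hadamard matrix is a flat isometry. -/

lemma sumSq_comp_equiv {α β : Type*} [Fintype α] [Fintype β] (e : α ≃ β) (v : β → ℝ) :
    sumSq (v ∘ e) = sumSq v :=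
  Fintype.sum_equiv e _ _ fun _ => rfl

lemma sumSq_sumElim {α β : Type*} [Fintype α] [Fintype β] (u : α → ℝ) (v : β → ℝ) :
    sumSq (Sum.elim u v) = sumSq u + sumSq v := by
  simp [sumSq]

lemma isFlatIsometry_walshHadamard (n : ℕ) : IsFlatIsometry (walshHadamard n) := by
  induction n with
  | zero =>
    refine ⟨fun v => by simp [walshHadamard], fun i j => ?_⟩
    obtain rfl : i = j := Subsingleton.elim (α := Fin 1) i j
    rw [walshHadamard, Matrix.one_apply_eq]
    simp
  | succ n ih =>
    have h2 : (1 / √(2 : ℝ)) ^ 2 = 1 / 2 := by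
      rw [div_pow, one_pow, Real.sq_sqrt (by norm_num)]
    constructor
    · intro v
      rw [walshHadamard, Matrix.smul_mulVec, sumSq_smul, h2]
      set e : Fin (2 ^ n) ⊕ Fin (2 ^ n) ≃ Fin (2 ^ (n + 1)) :=
        finSumFinEquiv.trans (finCongr (by rw [pow_succ]; omega))
      obtain ⟨w, rfl⟩ : ∃ w, v = w ∘ e.symm := ⟨v ∘ e, by funext i; simp⟩
      rw [Matrix.reindex_apply, Matrix.submatrix_mulVec_equiv]
      simp only [Equiv.symm_symm]
      rw [sumSq_comp_equiv, sumSq_comp_equiv, Function.comp_assoc, Equiv.symm_comp_self,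
        Function.comp_id]
      obtain ⟨a, b, rfl⟩ : ∃ a b, w = Sum.elim a b :=
        ⟨w ∘ Sum.inl, w ∘ Sum.inr, (Sum.elim_comp_inl_inr w).symm⟩
      rw [Matrix.fromBlocks_mulVec, sumSq_sumElim, sumSq_sumElim]
      simp only [Sum.elim_comp_inl, Sum.elim_comp_inr]
      rw [Matrix.neg_mulVec, ← ih.isometry a, ← ih.isometry b]
      simp only [sumSq, ← Finset.sum_add_distrib, Finset.mul_sum]
      refine Finset.sum_congr rfl fun i _ => ?_
      simp only [Pi.add_apply, Pi.neg_apply]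
      ring
    · intro i j
      have he : ∀ a b : Fin (2 ^ n) ⊕ Fin (2 ^ n),
          Matrix.fromBlocks (walshHadamard n) (walshHadamard n) (walshHadamard n)
            (-walshHadamard n) a b ^ 2 = 1 / 2 ^ n := by
        have := ih.entry
        simp only [Fintype.card_fin, Nat.cast_pow, Nat.cast_ofNat] at this
        rintro (a | a) (b | b) <;> simp [this]
      rw [walshHadamard, Matrix.smul_apply, smul_eq_mul, mul_pow, h2, Matrix.reindex_apply,
        Matrix.submatrix_apply, he, Fintype.card_fin, pow_succ]
      push_cast
      field_simp

/-! ### Distortion of one unit vector under uniform signs. -/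

section SingleVector

variable {k n : ℕ} {B : Matrix (Fin k) (Fin (2 ^ n)) ℝ}

/-- As diag(ξ) y = diag(y) ξ, the image is a Rademacher sum in `ξ` once `ξ'` is fixed. -/
lemma jlMatrix_mulVec (B : Matrix (Fin k) (Fin (2 ^ n)) ℝ) (ξ ξ' x : Fin (2 ^ n) → ℝ) :
    jlMatrix B ξ ξ' *ᵥ x
      = (B * Matrix.diagonal (walshHadamard n *ᵥ (x * ξ'))) *ᵥ ξ := by
  have h1 : Matrix.diagonal ξ' *ᵥ x = x * ξ' := by
    funext i; rw [Matrix.mulVec_diagonal, mul_comm]; rfl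
  rw [jlMatrix, ← Matrix.mulVec_mulVec, ← Matrix.mulVec_mulVec, ← Matrix.mulVec_mulVec,
    ← Matrix.mulVec_mulVec, h1]
  congr 1
  funext i
  rw [Matrix.mulVec_diagonal, Matrix.mulVec_diagonal, mul_comm]

/-- Tail bound for the distortion of the norm of a single unit vector. -/
lemma finProb_distortion_le (hB : IsFourWiseIndependent B) (hk : 4 ≤ k)
    {x : Fin (2 ^ n) → ℝ} (hx : sumSq x = 1) {L : ℝ} (hL : 1 ≤ L) :
    finProb (fun p : (Fin (2 ^ n) → Bool) × (Fin (2 ^ n) → Bool) => 1100 * √(L * √L / k)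
      < |√(sumSq (jlMatrix B (signVec p.1) (signVec p.2) *ᵥ x)) - 1|) ≤ 3 * Real.exp (-L) := by
  have hk0 : (0 : ℝ) < k := by exact_mod_cast (by omega : 0 < k)
  have hH := isFlatIsometry_walshHadamard n
  have hL0 : 0 < √L := Real.sqrt_pos.2 (by linarith)
  have hfix : ∀ s' : Fin (2 ^ n) → Bool,
      finProb (fun s : Fin (2 ^ n) → Bool => 1100 * √(L * √L / k)
        < |√(sumSq (jlMatrix B (signVec s) (signVec s') *ᵥ x)) - 1|)
      ≤ 2 * Real.exp (-L) + Set.indicator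
        {s' | 402 * √L < spread (walshHadamard n) (x * signVec s')} (fun _ => (1 : ℝ)) s' := by
    intro s'
    by_cases hs : 402 * √L < spread (walshHadamard n) (x * signVec s')
    · rw [Set.indicator_of_mem (by exact hs)]
      have h1 : finProb (fun s : Fin (2 ^ n) → Bool => 1100 * √(L * √L / k)
          < |√(sumSq (jlMatrix B (signVec s) (signVec s') *ᵥ x)) - 1|)
          ≤ 𝔼 _s : Fin (2 ^ n) → Bool, (1 : ℝ) :=
        finProb_le_expect (fun _ => zero_le_one) fun _ _ => le_rfl
      rw [Fintype.expect_const] at h1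
      linarith [Real.exp_pos (-L)]
    · rw [Set.indicator_of_notMem (by exact hs), add_zero]
      push Not at hs
      set y := walshHadamard n *ᵥ (x * signVec s') with hy
      have hF : frobSq (B * Matrix.diagonal y) = 1 := by
        rw [hB.frobSq_mul_diagonal (by omega), hy, hH.isometry, ← hx]
        refine Finset.sum_congr rfl fun i _ => ?_
        rw [Pi.mul_apply, mul_pow, signVec, sgn_sq, mul_one]
      have hop : OpSqLE (B * Matrix.diagonal y) (3618 * √L / k) := by
        refine (hB.opSqLE_mul_diagonal hk y).mono ?_
        have h1 : √((2 ^ n : ℕ) : ℝ) * lFourSq y ≤ 402 * √L := by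
          simpa only [spread, Fintype.card_fin] using hs
        calc _ = 9 / k * (√((2 ^ n : ℕ) : ℝ) * lFourSq y) := by ring
          _ ≤ 9 / k * (402 * √L) := by gcongr
          _ = _ := by ring
      have h2 := finProb_abs_sqrt_sumSq_sub_one_le _ hF hop (by positivity) (zero_le_one.trans hL)
      refine le_trans (finProb_mono fun s hs => ?_) h2
      rw [jlMatrix_mulVec] at hs
      refine lt_of_le_of_lt ?_ hs
      -- The constants are 3618 = 9 · 402 and 18 · 61 ≤ 1100.
      have h3 : √(3618 : ℝ) ≤ 61 := Real.sqrt_le_iff.2 ⟨by norm_num, by norm_num⟩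
      rw [show 3618 * √L / k * L = 3618 * (L * √L / k) by ring, Real.sqrt_mul (by norm_num)]
      nlinarith [Real.sqrt_nonneg (L * √L / k)]
  have hprod : finProb (fun p : (Fin (2 ^ n) → Bool) × (Fin (2 ^ n) → Bool) =>
      1100 * √(L * √L / k) < |√(sumSq (jlMatrix B (signVec p.1) (signVec p.2) *ᵥ x)) - 1|)
      = 𝔼 s' : Fin (2 ^ n) → Bool, finProb (fun s : Fin (2 ^ n) → Bool => 1100 * √(L * √L / k)
        < |√(sumSq (jlMatrix B (signVec s) (signVec s') *ᵥ x)) - 1|) := by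
    unfold finProb
    rw [Finset.expect_comm, ← Finset.univ_product_univ, Finset.expect_product]
    rfl
  rw [hprod]
  refine (Finset.expect_le_expect fun s' _ => hfix s').trans ?_
  rw [Finset.expect_add_distrib, Fintype.expect_const]
  have := finProb_spread_le hH hL hx.le
  unfold finProb at this
  linarith

end SingleVector

/-! ### From Rademacher families to uniform sign vectors. -/

section Transfer

variable {Ω ι : Type*} [MeasurableSpace Ω] {P : Measure Ω} {ξ : ι → Ω → ℝ}

lemma IsRademacher.measure_eq_sgn (h : IsRademacher P ξ) (i : ι) (b : Bool) :
    P (ξ i ⁻¹' {sgn b}) = 1 / 2 := by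
  cases b
  · exact h.prob_neg_one i
  · exact h.prob_one i

variable [Fintype ι]

lemma IsRademacher.measure_eq_signVec (h : IsRademacher P ξ) (s : ι → Bool) :
    P (⋂ i, ξ i ⁻¹' {sgn (s i)}) = ENNReal.ofReal (1 / 2 ^ Fintype.card ι) := by
  have h1 := h.indep.measure_inter_preimage_eq_mul Finset.univ (sets := fun i => {sgn (s i)})
    fun i _ => measurableSet_singleton _
  simp only [h.measure_eq_sgn, Finset.mem_univ, Set.iInter_true, Finset.prod_const,
    Finset.card_univ] at h1
  rw [h1, ← one_div_pow, ENNReal.ofReal_pow (by norm_num),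
    ENNReal.ofReal_div_of_pos (by norm_num)]
  simp

lemma finProb_nonneg {α : Type*} [Fintype α] (Q : α → Prop) : 0 ≤ finProb Q :=
  Finset.expect_nonneg fun a _ => Set.indicator_nonneg (fun _ _ => zero_le_one) a

lemma finProb_not {α : Type*} [Fintype α] [Nonempty α] (Q : α → Prop) :
    finProb Q = 1 - finProb fun a => ¬ Q a := by
  have h : finProb Q + finProb (fun a => ¬ Q a) = 1 := by
    unfold finProb
    rw [← Finset.expect_add_distrib]
    refine (Finset.expect_congr rfl fun a _ => ?_).trans (Fintype.expect_const (1 : ℝ))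
    by_cases hQ : Q a <;> simp [Set.indicator, hQ]
  linarith

variable [DecidableEq ι]

/-- A Rademacher family is distributed as a uniformly random sign vector. -/
lemma IsRademacher.measure_le_finProb [IsProbabilityMeasure P] (h : IsRademacher P ξ)
    (Q : (ι → ℝ) → Prop) :
    P {ω | Q fun i => ξ i ω} ≤ ENNReal.ofReal (finProb fun s : ι → Bool => Q (signVec s)) := by
  classical
  set G := Finset.univ.filter fun s : ι → Bool => ¬ Q (signVec s)
  set E : (ι → Bool) → Set Ω := fun s => ⋂ i, ξ i ⁻¹' {sgn (s i)} with hE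
  have hEm : ∀ s, MeasurableSet (E s) := fun s =>
    MeasurableSet.iInter fun i => h.measurable i (measurableSet_singleton _)
  have hEs : ∀ s ω, ω ∈ E s → (fun i => ξ i ω) = signVec s := fun s ω hω => by
    funext i
    exact Set.mem_iInter.1 hω i
  have hdisj : (G : Set (ι → Bool)).PairwiseDisjoint E := by
    intro s _ t _ hst
    refine Set.disjoint_left.2 fun ω h1 h2 => hst ?_
    have := (hEs s ω h1).symm.trans (hEs t ω h2)
    funext i
    exact sgn_injective (congrFun this i)
  have hU : P (⋃ s ∈ G, E s) = ENNReal.ofReal (finProb fun s : ι → Bool => ¬ Q (signVec s)) := by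
    rw [measure_biUnion_finset hdisj fun s _ => hEm s]
    simp only [hE, h.measure_eq_signVec, Finset.sum_const]
    rw [← ENNReal.ofReal_nsmul, finProb, Fintype.expect_eq_sum_div_card]
    simp only [Set.indicator_apply, Set.mem_ofPred_eq, Finset.sum_boole, nsmul_eq_mul]
    congr 1
    simp [G, div_eq_mul_inv]
  -- The event is covered by the complement of the finitely many good atoms, so it need not be
  -- measurable.
  have hsub : {ω | Q fun i => ξ i ω} ⊆ (⋃ s ∈ G, E s)ᶜ := by
    intro ω hω hmem
    simp only [Set.mem_iUnion] at hmem
    obtain ⟨s, hs, hωs⟩ := hmem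
    have h2 : ¬ Q (signVec s) := (Finset.mem_filter.1 hs).2
    rw [← hEs s ω hωs] at h2
    exact h2 hω
  refine (measure_mono hsub).trans ?_
  rw [prob_compl_eq_one_sub (Finset.measurableSet_biUnion G fun s _ => hEm s), hU,
    finProb_not (fun s : ι → Bool => Q (signVec s)),
    ENNReal.ofReal_sub _ (finProb_nonneg _)]
  simp

end Transfer

/-! ### Distortion of an arbitrary vector under `P`. -/

section Distortion

variable {k n : ℕ} {B : Matrix (Fin k) (Fin (2 ^ n)) ℝ}

lemma norm_toEuclideanLin (A : Matrix (Fin k) (Fin (2 ^ n)) ℝ)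
    (x : EuclideanSpace ℝ (Fin (2 ^ n))) : ‖A.toEuclideanLin x‖ = √(sumSq (A *ᵥ x.ofLp)) := by
  simp [EuclideanSpace.norm_eq, sumSq, Matrix.toLpLin_apply]

/-- Tail bound for the distortion of the norm of a single vector. -/
lemma IsFourWiseIndependent.measure_distortion_le (hB : IsFourWiseIndependent B) (hk : 4 ≤ k)
    {Ω : Type*} [MeasurableSpace Ω] {P : Measure Ω} [IsProbabilityMeasure P]
    {ξ ξ' : Fin (2 ^ n) → Ω → ℝ} (h : IsRademacher P (Sum.elim ξ ξ'))
    (z : EuclideanSpace ℝ (Fin (2 ^ n))) {L : ℝ} (hL : 1 ≤ L) :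
    P {ω | 1100 * √(L * √L / k) * ‖z‖
      < |‖(jlMatrix B (fun i => ξ i ω) fun i => ξ' i ω).toEuclideanLin z‖ - ‖z‖|}
      ≤ ENNReal.ofReal (3 * Real.exp (-L)) := by
  rcases eq_or_ne z 0 with rfl | hz
  · simp
  have hz0 : 0 < ‖z‖ := norm_pos_iff.2 hz
  set x := ‖z‖⁻¹ • z with hx
  have hx1 : sumSq x.ofLp = 1 := by
    have : ‖x‖ = 1 := by rw [hx, norm_smul, norm_inv, norm_norm, inv_mul_cancel₀ hz0.ne']
    rw [EuclideanSpace.norm_eq, Real.sqrt_eq_one] at this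
    simpa [sumSq] using this
  set Q : (Fin (2 ^ n) ⊕ Fin (2 ^ n) → ℝ) → Prop := fun w => 1100 * √(L * √L / k)
    < |√(sumSq (jlMatrix B (w ∘ Sum.inl) (w ∘ Sum.inr) *ᵥ x.ofLp)) - 1| with hQ
  have hsub : {ω | 1100 * √(L * √L / k) * ‖z‖
      < |‖(jlMatrix B (fun i => ξ i ω) fun i => ξ' i ω).toEuclideanLin z‖ - ‖z‖|}
      ⊆ {ω | Q fun i => Sum.elim ξ ξ' i ω} := by
    intro ω hω
    set A := jlMatrix B (fun i => ξ i ω) fun i => ξ' i ω with hA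
    have hω' : 1100 * √(L * √L / k) * ‖z‖ < |‖A.toEuclideanLin z‖ - ‖z‖| := hω
    have hzx : z = ‖z‖ • x := by rw [hx, smul_inv_smul₀ hz0.ne']
    have hAz : ‖A.toEuclideanLin z‖ = ‖z‖ * ‖A.toEuclideanLin x‖ := by
      conv_lhs => rw [hzx]
      rw [map_smul, norm_smul, norm_norm]
    rw [hAz, ← mul_sub_one, abs_mul, abs_of_pos hz0, mul_comm, mul_lt_mul_iff_right₀ hz0,
      norm_toEuclideanLin] at hω'
    exact hω'
  refine (measure_mono hsub).trans ((h.measure_le_finProb Q).trans (ENNReal.ofReal_le_ofReal ?_))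
  refine le_trans (le_of_eq ?_) (finProb_distortion_le hB hk hx1 hL)
  unfold finProb
  exact Fintype.expect_equiv (Equiv.sumArrowEquivProdArrow _ _ _) _ _ fun _ => rfl

end Distortion

/-! ### Deterministic chaining and dyadic nets. -/

/-- Successive approximation of the values of a linear map along nets of dyadic radii. -/
lemma exists_norm_map_sub_le_of_nets {V W : Type*} [NormedAddCommGroup V] [NormedSpace ℝ V]
    [NormedAddCommGroup W] [NormedSpace ℝ W] (A : V →L[ℝ] W) {S : Set V} {F : ℕ → Finset V}
    (hF : ∀ j, ∀ x ∈ S, ∃ u ∈ F j, ‖x - u‖ ≤ 1 / 2 ^ j) (J : ℕ) {δ : ℕ → ℝ} {R : ℝ}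
    (hδ : ∀ i, 0 ≤ δ i)
    (hA : ∀ i, ∀ u ∈ F (J + i), ∀ v ∈ F (J + i + 1), ‖A (u - v)‖ ≤ (1 + δ i) * ‖u - v‖)
    (hR : ∀ n, ∑ i ∈ Finset.range n, 1 / 2 ^ (J + i) * δ i ≤ R) {x : V} (hx : x ∈ S) :
    ∃ u ∈ F J, ‖A x - A u‖ ≤ 4 / 2 ^ J + 2 * R := by
  choose π hπF hπ using fun j => hF j x hx
  refine ⟨π J, hπF J, ?_⟩
  have hstep : ∀ i, ‖A (π (J + i + 1)) - A (π (J + i))‖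
      ≤ 2 * (1 / 2 ^ (J + i)) + 2 * (1 / 2 ^ (J + i) * δ i) := by
    intro i
    have h1 : ‖π (J + i) - π (J + i + 1)‖ ≤ 2 * (1 / 2 ^ (J + i)) := by
      have h2 : (1 : ℝ) / 2 ^ (J + i + 1) ≤ 1 / 2 ^ (J + i) :=
        one_div_pow_le_one_div_pow_of_le (by norm_num) (Nat.le_succ _)
      calc _ ≤ ‖π (J + i) - x‖ + ‖x - π (J + i + 1)‖ := norm_sub_le_norm_sub_add_norm_sub _ _ _
        _ ≤ 1 / 2 ^ (J + i) + 1 / 2 ^ (J + i + 1) := by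
          rw [norm_sub_rev]; exact add_le_add (hπ _) (hπ _)
        _ ≤ _ := by linarith
    rw [← map_sub, ← neg_sub, map_neg, norm_neg]
    calc _ ≤ (1 + δ i) * ‖π (J + i) - π (J + i + 1)‖ := hA i _ (hπF _) _ (hπF _)
      _ ≤ (1 + δ i) * (2 * (1 / 2 ^ (J + i))) := by
        gcongr; linarith [hδ i]
      _ = _ := by ring
  have hgeom : ∀ n : ℕ, ∑ i ∈ Finset.range n, (1 : ℝ) / 2 ^ (J + i) = (2 - 2 / 2 ^ n) / 2 ^ J := by
    intro n
    induction n with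
    | zero => simp
    | succ n ih =>
      rw [Finset.sum_range_succ, ih, pow_add, pow_succ]
      field_simp
      ring
  have hsum : ∀ n, ‖A (π (J + n)) - A (π J)‖ ≤ 4 / 2 ^ J + 2 * R := by
    intro n
    have h1 : ‖A (π (J + n)) - A (π J)‖ ≤ ∑ i ∈ Finset.range n,
        (2 * (1 / 2 ^ (J + i)) + 2 * (1 / 2 ^ (J + i) * δ i)) := by
      have h2 := Finset.sum_range_sub (fun i => A (π (J + i))) n
      simp only [add_zero] at h2
      rw [← h2]
      exact norm_sum_le_of_le _ fun i _ => hstep i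
    have h3 := hgeom n
    have h4 : (2 - 2 / 2 ^ n) / 2 ^ J ≤ (2 : ℝ) / 2 ^ J := by
      gcongr
      have : (0 : ℝ) < 2 / 2 ^ n := by positivity
      linarith
    rw [Finset.sum_add_distrib, ← Finset.mul_sum, ← Finset.mul_sum, h3] at h1
    have := hR n
    have h5 : (4 : ℝ) / 2 ^ J = 2 * (2 / 2 ^ J) := by ring
    linarith
  have hlim : Filter.Tendsto (fun n => π (J + n)) Filter.atTop (nhds x) := by
    rw [tendsto_iff_norm_sub_tendsto_zero]
    refine squeeze_zero (fun _ => norm_nonneg _) (fun n => (norm_sub_rev _ _).trans_le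
      ((hπ (J + n)).trans (?_ : _ ≤ ((1 : ℝ) / 2) ^ n)))
      (tendsto_pow_atTop_nhds_zero_of_lt_one (by norm_num) (by norm_num))
    rw [one_div_pow]
    gcongr
    · norm_num
    · omega
  exact le_of_tendsto (((A.continuous.tendsto x).comp hlim).sub_const _).norm
    (Filter.Eventually.of_forall hsum)

/-- Bounded sets here have compact closure, so the covering numbers are finite and `toNat` loses
nothing. -/
lemma exists_nets {n : ℕ} {S : Set (EuclideanSpace ℝ (Fin n))} (hS : Bornology.IsBounded S) :
    ∃ F : ℕ → Finset (EuclideanSpace ℝ (Fin n)),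
      (∀ j, (F j : Set (EuclideanSpace ℝ (Fin n))) ⊆ S) ∧
      (∀ j, (F j).card = (Metric.coveringNumber (1 / 2 ^ j : ℝ≥0) S).toNat) ∧
      ∀ j, ∀ x ∈ S, ∃ u ∈ F j, ‖x - u‖ ≤ 1 / 2 ^ j := by
  have hcov : ∀ j : ℕ, Metric.coveringNumber (1 / 2 ^ j : ℝ≥0) S ≠ ⊤ := by
    intro j
    obtain ⟨N, hNS, hNf, hN⟩ := Metric.exists_finite_isCover_of_isCompact_closure
      (ε := 1 / 2 ^ j) (by positivity) hS.isCompact_closure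
    exact ((hN.coveringNumber_le_encard hNS).trans_lt hNf.encard_lt_top).ne
  refine ⟨fun j => (Metric.finite_minimalCover (ε := 1 / 2 ^ j) (A := S)).toFinset, fun j => ?_,
    fun j => ?_, fun j x hx => ?_⟩
  · rw [Set.Finite.coe_toFinset]
    exact Metric.minimalCover_subset
  · rw [← Metric.encard_minimalCover (hcov j),
      Metric.finite_minimalCover.encard_eq_coe_toFinset_card]
    rfl
  · have := (Metric.isCover_iff_subset_iUnion_closedBall.1
      (Metric.isCover_minimalCover (hcov j))) hx
    simp only [Set.mem_iUnion, Metric.mem_closedBall] at this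
    obtain ⟨u, hu, hxu⟩ := this
    refine ⟨u, by simpa using hu, ?_⟩
    rw [← dist_eq_norm]
    simpa using hxu

/-- Rewrites the deviation of a single vector in the power that occurs in the entropy sum. -/
lemma sqrt_mul_sqrt_div (L : ℝ) (hL : 0 ≤ L) (k : ℝ) :
    √(L * √L / k) = L ^ (3 / 4 : ℝ) / √k := by
  rw [Real.sqrt_div (by positivity)]
  congr 1
  rw [Real.sqrt_eq_rpow, Real.sqrt_eq_rpow, ← Real.rpow_one_add' hL (by norm_num),
    ← Real.rpow_mul hL]
  norm_num

lemma sum_add_three_div_two_pow_le (n : ℕ) :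
    ∑ i ∈ Finset.range n, (1 : ℝ) / 2 ^ i * (i + 3) ≤ 8 := by
  have h : ∑ i ∈ Finset.range n, (1 : ℝ) / 2 ^ i * (i + 3) = 8 - (2 * n + 8) / 2 ^ n := by
    induction n with
    | zero => simp
    | succ n ih =>
      rw [Finset.sum_range_succ, ih, pow_succ]
      push_cast
      field_simp
      ring
  rw [h]
  have : (0 : ℝ) ≤ (2 * n + 8) / 2 ^ n := by positivity
  linarith

/-! ### Union bounds along the chain. -/

section Chaining

variable {k n : ℕ} {B : Matrix (Fin k) (Fin (2 ^ n)) ℝ} {Ω : Type*} [MeasurableSpace Ω]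
  {P : Measure Ω} [IsProbabilityMeasure P] {ξ ξ' : Fin (2 ^ n) → Ω → ℝ}

/-- The event that the norm of `z` is distorted by more than the level `L` allows. -/
def distortionEvent (B : Matrix (Fin k) (Fin (2 ^ n)) ℝ) (ξ ξ' : Fin (2 ^ n) → Ω → ℝ)
    (z : EuclideanSpace ℝ (Fin (2 ^ n))) (L : ℝ) : Set Ω :=
  {ω | 1100 * √(L * √L / k) * ‖z‖
      < |‖(jlMatrix B (fun i => ξ i ω) fun i => ξ' i ω).toEuclideanLin z‖ - ‖z‖|}

/-- In the level L, the logarithm of the cardinality pays for the union bound, log(1/p) gives the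
factor p, and i + 3 makes the bounds summable in i while absorbing the 3 of the tail bound. -/
lemma IsFourWiseIndependent.measure_iUnion_distortionEvent_le (hB : IsFourWiseIndependent B)
    (hk : 4 ≤ k) (h : IsRademacher P (Sum.elim ξ ξ')) {α : Type*} (F : Finset α)
    (f : α → EuclideanSpace ℝ (Fin (2 ^ n))) (i : ℕ) {L p : ℝ} (hp : 0 < p) (hp1 : p < 1)
    (hL : L = Real.log F.card + (Real.log (1 / p) + (i + 3))) :
    P (⋃ t ∈ F, distortionEvent B ξ ξ' (f t) L) ≤ ENNReal.ofReal (p / 4 * (1 / 2) ^ i) := by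
  rcases F.eq_empty_or_nonempty with rfl | hF
  · simp
  have hc : (0 : ℝ) < F.card := by exact_mod_cast hF.card_pos
  have hlogp : 0 ≤ Real.log (1 / p) := Real.log_nonneg (by rw [le_div_iff₀ hp]; linarith)
  have hlogc : 0 ≤ Real.log F.card := Real.log_natCast_nonneg _
  have hL1 : 1 ≤ L := by
    rw [hL]
    have : (0 : ℝ) ≤ i := i.cast_nonneg
    linarith
  calc _ ≤ ∑ t ∈ F, P (distortionEvent B ξ ξ' (f t) L) := measure_biUnion_finset_le _ _
    _ ≤ ∑ _t ∈ F, ENNReal.ofReal (3 * Real.exp (-L)) :=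
      Finset.sum_le_sum fun t _ => hB.measure_distortion_le hk h (f t) hL1
    _ = ENNReal.ofReal (F.card * (3 * Real.exp (-L))) := by
      rw [Finset.sum_const, ← ENNReal.ofReal_nsmul, nsmul_eq_mul]
    _ ≤ _ := by
      refine ENNReal.ofReal_le_ofReal ?_
      have e1 : Real.exp (-L) = (F.card : ℝ)⁻¹ * (p * (Real.exp (-1) ^ i * Real.exp (-3))) := by
        rw [hL, neg_add, neg_add, neg_add, Real.exp_add, Real.exp_add, Real.exp_add,
          Real.exp_neg (Real.log _), Real.exp_log hc, Real.exp_neg (Real.log _),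
          Real.exp_log (by positivity), one_div, inv_inv, ← Real.exp_nat_mul]
        ring_nf
      have e2 : Real.exp (-1) ≤ 1 / 2 := by
        rw [Real.exp_neg, ← one_div]
        gcongr
        linarith [Real.add_one_le_exp (1 : ℝ)]
      have e3 : Real.exp (-3) ≤ 1 / 12 := by
        rw [Real.exp_neg, ← one_div]
        gcongr
        have h3 : Real.exp 3 = Real.exp 1 ^ 3 := by rw [← Real.exp_nat_mul]; norm_num
        have h4 : (2.7 : ℝ) ^ 3 ≤ Real.exp 1 ^ 3 := by
          gcongr; linarith [Real.exp_one_gt_d9]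
        rw [h3]
        norm_num at h4 ⊢
        linarith
      calc _ = 3 * p * (Real.exp (-1) ^ i * Real.exp (-3)) := by rw [e1]; field_simp
        _ ≤ 3 * p * ((1 / 2) ^ i * (1 / 12)) := by gcongr
        _ = _ := by ring

lemma rpow_add_le {a b : ℝ} (ha : 0 ≤ a) (hb : 0 ≤ b) :
    (a + b) ^ (3 / 4 : ℝ) ≤ a ^ (3 / 4 : ℝ) + b ^ (3 / 4 : ℝ) :=
  Real.rpow_add_le_add_rpow ha hb (by norm_num) (by norm_num)

lemma rpow_le_self {a : ℝ} (ha : 1 ≤ a) : a ^ (3 / 4 : ℝ) ≤ a := by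
  nth_rewrite 2 [← Real.rpow_one a]
  exact Real.rpow_le_rpow_of_exponent_le ha (by norm_num)

set_option maxHeartbeats 800000 in
/-- The conclusion, with the hypotheses on `k` in terms of real numbers. -/
lemma IsFourWiseIndependent.measure_isJLMap_ge (hB : IsFourWiseIndependent B) (hk : 4 ≤ k)
    (h : IsRademacher P (Sum.elim ξ ξ')) {S : Set (EuclideanSpace ℝ (Fin (2 ^ n)))}
    (hS : S ⊆ Metric.sphere 0 1) {ε p E : ℝ} (hε : 0 < ε) (hε1 : ε < 1) (hp : 0 < p)
    (hp1 : p < 1)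
    (hE : ∀ F : Finset ℕ, ∑ j ∈ F, 1 / 2 ^ j * Real.log
      ((Metric.coveringNumber (1 / 2 ^ j : ℝ≥0) S).toNat : ℝ) ^ (3 / 4 : ℝ) ≤ E)
    (hkE : 1100000 * (Real.log (1 / p) ^ (3 / 4 : ℝ) + E) ≤ ε ^ 2 * √(k : ℝ))
    (hkε : 550000 ≤ ε * √(k : ℝ)) :
    ENNReal.ofReal (1 - p)
      ≤ P {ω | IsJLMap ε (jlMatrix B (fun i => ξ i ω) (fun i => ξ' i ω)) S} := by
  have hk0 : (0 : ℝ) < k := by exact_mod_cast (by omega : 0 < k)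
  have hks : 0 < √(k : ℝ) := Real.sqrt_pos.2 hk0
  obtain ⟨F, hFS, hFcard, hFnet⟩ := exists_nets (Metric.isBounded_sphere.subset hS)
  simp only [← hFcard] at hE
  set l : ℕ → ℝ := fun j => Real.log (F j).card ^ (3 / 4 : ℝ) with hl
  set lp := Real.log (1 / p) ^ (3 / 4 : ℝ) with hlp
  have hlogp : 0 ≤ Real.log (1 / p) := Real.log_nonneg (by rw [le_div_iff₀ hp]; linarith)
  have hlogc : ∀ j, 0 ≤ Real.log (F j).card := fun j => Real.log_natCast_nonneg _
  have hlp0 : 0 ≤ lp := Real.rpow_nonneg hlogp _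
  have hl0 : ∀ j, 0 ≤ l j := fun j => Real.rpow_nonneg (hlogc j) _
  have hE0 : 0 ≤ E := by simpa using hE ∅
  -- The chain starts at the first scale below ε/32, so that 2^J is still at most 64/ε.
  obtain ⟨m, hm1, hm2⟩ := exists_nat_pow_near_of_lt_one (show 0 < ε / 32 by positivity)
    (by linarith) (show (0 : ℝ) < 1 / 2 by norm_num) (by norm_num)
  obtain ⟨J, hJ1, hJ2⟩ : ∃ J : ℕ, (1 : ℝ) / 2 ^ J ≤ ε / 32 ∧ (2 : ℝ) ^ J ≤ 64 / ε := by
    refine ⟨m + 1, by rw [← one_div_pow]; exact hm1.le, ?_⟩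
    rw [one_div_pow, le_div_iff₀ (by positivity)] at hm2
    rw [le_div_iff₀ hε, pow_succ]
    linarith
  have hJ0 : (1 : ℝ) / 2 ^ J ≤ 1 := by linarith
  set L0 := Real.log (F J).card + (Real.log (1 / p) + ((0 : ℕ) + 3)) with hL0
  set L : ℕ → ℝ := fun i =>
    Real.log (F (J + i) ×ˢ F (J + i + 1)).card + (Real.log (1 / p) + (i + 3)) with hL
  set bad : Set Ω := (⋃ t ∈ F J, distortionEvent B ξ ξ' t L0) ∪
    ⋃ i : ℕ, ⋃ t ∈ F (J + i) ×ˢ F (J + i + 1), distortionEvent B ξ ξ' (t.1 - t.2) (L i) with hbad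
  have hPbad : P bad ≤ ENNReal.ofReal p := by
    have h1 := hB.measure_iUnion_distortionEvent_le hk h (F J) id 0 hp hp1 hL0
    have h2 : P (⋃ i : ℕ, ⋃ t ∈ F (J + i) ×ˢ F (J + i + 1),
        distortionEvent B ξ ξ' (t.1 - t.2) (L i)) ≤ ENNReal.ofReal (p / 4 * 2) := by
      refine (measure_iUnion_le _).trans ?_
      refine (ENNReal.tsum_le_tsum fun i => hB.measure_iUnion_distortionEvent_le hk h
        (F (J + i) ×ˢ F (J + i + 1)) (fun t => t.1 - t.2) i hp hp1 rfl).trans ?_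
      rw [← ENNReal.ofReal_tsum_of_nonneg (fun i => by positivity)
        (summable_geometric_two.mul_left _), tsum_mul_left, tsum_geometric_two]
    calc P bad ≤ _ := measure_union_le _ _
      _ ≤ ENNReal.ofReal (p / 4 * (1 / 2) ^ 0) + ENNReal.ofReal (p / 4 * 2) := add_le_add h1 h2
      _ = ENNReal.ofReal (p / 4 * (1 / 2) ^ 0 + p / 4 * 2) :=
        (ENNReal.ofReal_add (by positivity) (by positivity)).symm
      _ ≤ _ := ENNReal.ofReal_le_ofReal (by linarith)
  have hgood : badᶜ ⊆ {ω | IsJLMap ε (jlMatrix B (fun i => ξ i ω) (fun i => ξ' i ω)) S} := by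
    intro ω hω x hx
    set A := jlMatrix B (fun i => ξ i ω) fun i => ξ' i ω with hA
    have hω1 : ∀ z ∈ F J, |‖A.toEuclideanLin z‖ - ‖z‖| ≤ 1100 * √(L0 * √L0 / k) * ‖z‖ := by
      intro z hz
      by_contra! hcon
      exact hω (Or.inl (Set.mem_biUnion (Finset.mem_coe.2 hz) hcon))
    have hω2 : ∀ i, ∀ u ∈ F (J + i), ∀ v ∈ F (J + i + 1),
        |‖A.toEuclideanLin (u - v)‖ - ‖u - v‖| ≤ 1100 * √(L i * √(L i) / k) * ‖u - v‖ := by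
      intro i u hu v hv
      by_contra! hcon
      refine hω (Or.inr (Set.mem_iUnion.2 ⟨i, Set.mem_iUnion₂.2
        ⟨(u, v), Finset.mem_product.2 ⟨hu, hv⟩, hcon⟩⟩))
    have hLle : ∀ i, √(L i * √(L i) / k)
        ≤ (l (J + i) + l (J + i + 1) + lp + (i + 3)) / √(k : ℝ) := by
      intro i
      have hi : (0 : ℝ) ≤ i := i.cast_nonneg
      have hLi : L i ≤ Real.log (F (J + i)).card + Real.log (F (J + i + 1)).card
          + Real.log (1 / p) + (i + 3) := by
        simp only [hL, Finset.card_product, Nat.cast_mul]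
        -- For an empty net the estimate survives because `Real.log 0 = 0`.
        rcases Nat.eq_zero_or_pos (F (J + i)).card with h0 | h0
        · simp only [h0, Nat.cast_zero, zero_mul, Real.log_zero]
          linarith [hlogc (J + i + 1)]
        rcases Nat.eq_zero_or_pos (F (J + i + 1)).card with h0' | h0'
        · simp only [h0', Nat.cast_zero, mul_zero, Real.log_zero]
          linarith [hlogc (J + i)]
        rw [Real.log_mul (by positivity) (by positivity)]
        linarith
      have hLi0 : 0 ≤ L i := by
        have : 0 ≤ Real.log (F (J + i) ×ˢ F (J + i + 1)).card := Real.log_natCast_nonneg _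
        simp only [hL]
        linarith
      rw [sqrt_mul_sqrt_div _ hLi0]
      gcongr
      have c1 := hlogc (J + i)
      have c2 := hlogc (J + i + 1)
      calc L i ^ (3 / 4 : ℝ) ≤ _ := Real.rpow_le_rpow hLi0 hLi (by norm_num)
        _ ≤ _ := rpow_add_le (by linarith) (by linarith)
        _ ≤ _ := add_le_add (rpow_add_le (by linarith) (by linarith)) (rpow_le_self (by linarith))
        _ ≤ _ := by
          gcongr
          exact rpow_add_le c1 c2
    have hL0le : √(L0 * √L0 / k) ≤ (l J + lp + 3) / √(k : ℝ) := by
      have c1 := hlogc J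
      have hL00 : 0 ≤ L0 := by rw [hL0]; push_cast; linarith
      rw [sqrt_mul_sqrt_div _ hL00]
      gcongr
      rw [hL0, ← add_assoc, Nat.cast_zero, zero_add]
      calc _ ≤ _ := rpow_add_le (by linarith) (by linarith)
        _ ≤ _ := add_le_add (rpow_add_le c1 hlogp) (rpow_le_self (by norm_num))
    have hR : ∀ N, ∑ i ∈ Finset.range N, 1 / 2 ^ (J + i) * (1100 * √(L i * √(L i) / k))
        ≤ 19 * ε / 1000 := by
      intro N
      have s1 : ∑ i ∈ Finset.range N, 1 / 2 ^ (J + i) * l (J + i) ≤ E := by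
        have := hE (Finset.Ico J (J + N))
        rwa [Finset.sum_Ico_eq_sum_range, Nat.add_sub_cancel_left] at this
      have s2 : ∑ i ∈ Finset.range N, 1 / 2 ^ (J + i) * l (J + i + 1) ≤ 2 * E := by
        have := hE (Finset.Ico (J + 1) (J + 1 + N))
        rw [Finset.sum_Ico_eq_sum_range, Nat.add_sub_cancel_left] at this
        calc _ = 2 * ∑ i ∈ Finset.range N, 1 / 2 ^ (J + 1 + i) * l (J + 1 + i) := by
              rw [Finset.mul_sum]
              refine Finset.sum_congr rfl fun i _ => ?_
              rw [show J + 1 + i = J + i + 1 by ring, pow_succ (2 : ℝ) (J + i)]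
              field_simp
          _ ≤ _ := by gcongr
      have s3 : ∑ i ∈ Finset.range N, 1 / (2 : ℝ) ^ (J + i) ≤ 2 := by
        calc _ = 1 / 2 ^ J * ∑ i ∈ Finset.range N, (1 / (2 : ℝ)) ^ i := by
              rw [Finset.mul_sum]
              refine Finset.sum_congr rfl fun i _ => ?_
              rw [one_div_pow, pow_add]; field_simp
          _ ≤ 1 * 2 := by
              gcongr
              exact sum_geometric_two_le N
          _ = 2 := one_mul 2
      have s4 : ∑ i ∈ Finset.range N, 1 / (2 : ℝ) ^ (J + i) * (i + 3) ≤ 8 := by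
        calc _ = 1 / 2 ^ J * ∑ i ∈ Finset.range N, 1 / (2 : ℝ) ^ i * (i + 3) := by
              rw [Finset.mul_sum]
              refine Finset.sum_congr rfl fun i _ => ?_
              rw [pow_add]; field_simp
          _ ≤ 1 * 8 := by
              gcongr
              exact sum_add_three_div_two_pow_le N
          _ = 8 := one_mul 8
      calc _ ≤ ∑ i ∈ Finset.range N, 1100 / √(k : ℝ) * (1 / 2 ^ (J + i) * l (J + i)
            + 1 / 2 ^ (J + i) * l (J + i + 1) + 1 / 2 ^ (J + i) * lp
            + 1 / 2 ^ (J + i) * (i + 3)) := by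
            refine Finset.sum_le_sum fun i _ => ?_
            calc _ ≤ 1 / 2 ^ (J + i) * (1100 * ((l (J + i) + l (J + i + 1) + lp + (i + 3))
                  / √(k : ℝ))) := by gcongr; exact hLle i
              _ = _ := by field_simp
        _ ≤ 1100 / √(k : ℝ) * (E + 2 * E + 2 * lp + 8) := by
            rw [← Finset.mul_sum, Finset.sum_add_distrib, Finset.sum_add_distrib,
              Finset.sum_add_distrib, ← Finset.sum_mul]
            gcongr
        _ ≤ _ := by
            rw [div_mul_eq_mul_div, div_le_iff₀ hks]
            have : ε ^ 2 * √(k : ℝ) ≤ ε * √(k : ℝ) := by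
              gcongr; nlinarith
            linarith
    obtain ⟨u, huF, hu⟩ := exists_norm_map_sub_le_of_nets A.toEuclideanLin.toContinuousLinearMap
      hFnet J (δ := fun i => 1100 * √(L i * √(L i) / k)) (fun i => by positivity)
      (fun i u hu v hv => by
        have := (abs_le.1 (hω2 i u hu v hv)).2
        rw [LinearMap.coe_toContinuousLinearMap', add_mul, one_mul]
        linarith) hR hx
    simp only [LinearMap.coe_toContinuousLinearMap'] at hu
    have hx1 : ‖x‖ = 1 := by simpa using hS hx
    have hu1 : ‖u‖ = 1 := by simpa using hS (hFS J huF)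
    have hAu := hω1 u huF
    rw [hu1, mul_one] at hAu
    -- A single term of the entropy sum is multiplied by 2^J; this loss of 1/ε is why k must grow
    -- like ε^{-4}.
    have hlJ : l J ≤ 64 / ε * E := by
      have h1 := hE {J}
      rw [Finset.sum_singleton, one_div, inv_mul_le_iff₀ (by positivity)] at h1
      exact h1.trans (by gcongr)
    have hδ0 : 1100 * √(L0 * √L0 / k) ≤ 70 * ε / 1000 := by
      calc _ ≤ 1100 * ((l J + lp + 3) / √(k : ℝ)) := by gcongr
        _ ≤ 1100 * ((64 / ε * E + 64 / ε * lp + 3) / √(k : ℝ)) := by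
            gcongr
            refine le_mul_of_one_le_left hlp0 ?_
            rw [le_div_iff₀ hε]; linarith
        _ ≤ _ := by
            rw [← mul_div_assoc, div_le_iff₀ hks]
            have : 64 / ε * E + 64 / ε * lp ≤ 64 * (ε * √(k : ℝ)) / 1100000 := by
              rw [← mul_add, div_mul_eq_mul_div, div_le_iff₀ hε]
              have : 64 * (ε * √(k : ℝ)) / 1100000 * ε = 64 / 1100000 * (ε ^ 2 * √(k : ℝ)) := by
                ring
              linarith
            linarith
    -- The contributions are 4ε/32 from the lengths, 38ε/1000 from the increments and 70ε/1000 from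
    -- the starting net. A norm error of ε/4 gives at most ε after squaring.
    have hdist : |‖A.toEuclideanLin x‖ - 1| ≤ ε / 4 := by
      have h1 := abs_norm_sub_norm_le (A.toEuclideanLin x) (A.toEuclideanLin u)
      have h2 : (4 : ℝ) / 2 ^ J = 4 * (1 / 2 ^ J) := by ring
      calc _ ≤ |‖A.toEuclideanLin x‖ - ‖A.toEuclideanLin u‖| + |‖A.toEuclideanLin u‖ - 1| :=
            abs_sub_le _ _ _
        _ ≤ _ := by linarith
    rw [abs_le] at hdist
    rw [hx1]
    constructor <;> nlinarith [norm_nonneg (A.toEuclideanLin x)]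
  -- Subadditivity suffices here, so no measurability of the bad event is needed.
  have htot : (1 : ℝ≥0∞) ≤ P bad + P badᶜ := by
    rw [← measure_univ (μ := P), ← Set.union_compl_self bad]
    exact measure_union_le _ _
  rw [ENNReal.ofReal_sub _ hp.le, ENNReal.ofReal_one]
  refine tsub_le_iff_left.2 (htot.trans (add_le_add hPbad (measure_mono hgood)))

end Chaining

/-! ### Choice of the constant and conclusion. -/

lemma half_le_log_rpow {p : ℝ} (hp : 0 < p) (hp2 : p ≤ 1 / 2) :
    1 / 2 ≤ Real.log (1 / p) ^ (3 / 4 : ℝ) := by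
  have h1 : 1 / 2 ≤ Real.log (1 / p) := by
    have h2 : Real.log 2 ≤ Real.log (1 / p) := by
      apply Real.log_le_log (by norm_num)
      rw [le_div_iff₀ hp]; linarith
    linarith [Real.log_two_gt_d9]
  calc (1 / 2 : ℝ) = (1 / 2) ^ (1 : ℝ) := (Real.rpow_one _).symm
    _ ≤ (1 / 2) ^ (3 / 4 : ℝ) :=
      Real.rpow_le_rpow_of_exponent_ge (by norm_num) (by norm_num) (by norm_num)
    _ ≤ _ := Real.rpow_le_rpow (by norm_num) h1 (by norm_num)

theorem theorem2 :
    ∃ C : ℝ, 1 ≤ C ∧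
      ∀ (k n : ℕ) (B : Matrix (Fin k) (Fin (2 ^ n)) ℝ), IsFourWiseIndependent B →
      ∀ (Ω : Type*) [MeasurableSpace Ω] (P : Measure Ω) [IsProbabilityMeasure P]
        (ξ ξ' : Fin (2 ^ n) → Ω → ℝ), IsRademacher P (Sum.elim ξ ξ') →
      ∀ (S : Set (EuclideanSpace ℝ (Fin (2 ^ n)))), S ⊆ Metric.sphere 0 1 →
      ∀ (ε p : ℝ), 0 < ε → ε < 1 → 0 < p → p < 1 →
        (1 / 2 < p → C / ε ^ 2 ≤ (k : ℝ)) →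
        ENNReal.ofReal (C / ε ^ 4) *
            (ENNReal.ofReal (Real.log (1 / p) ^ (3 / 4 : ℝ)) + entropySum S) ^ 2 ≤ (k : ℝ≥0∞) →
        ENNReal.ofReal (1 - p) ≤
          P {ω | IsJLMap ε (jlMatrix B (fun i => ξ i ω) (fun i => ξ' i ω)) S} := by
  refine ⟨1100000 ^ 2, by norm_num, ?_⟩
  intro k n B hB Ω _ P _ ξ ξ' hξ S hS ε p hε hε1 hp hp1 hkp hkS
  have hlogp : 0 ≤ Real.log (1 / p) := Real.log_nonneg (by rw [le_div_iff₀ hp]; linarith)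
  set lp := Real.log (1 / p) ^ (3 / 4 : ℝ) with hlp
  have hlp0 : 0 ≤ lp := Real.rpow_nonneg hlogp _
  have hC : 0 < (1100000 : ℝ) ^ 2 / ε ^ 4 := by positivity
  have hfin : entropySum S ≠ ⊤ := by
    intro htop
    rw [htop, add_top, ENNReal.top_pow two_ne_zero,
      ENNReal.mul_top (ENNReal.ofReal_pos.2 hC).ne', top_le_iff] at hkS
    exact ENNReal.natCast_ne_top k hkS
  set E := (entropySum S).toReal with hEdef
  have hE0 : 0 ≤ E := ENNReal.toReal_nonneg
  have hE : ∀ F : Finset ℕ, ∑ j ∈ F, 1 / 2 ^ j * Real.log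
      ((Metric.coveringNumber (1 / 2 ^ j : ℝ≥0) S).toNat : ℝ) ^ (3 / 4 : ℝ) ≤ E := by
    intro F
    have h0 : ∀ j ∈ F, 0 ≤ 1 / 2 ^ j * Real.log
        ((Metric.coveringNumber (1 / 2 ^ j : ℝ≥0) S).toNat : ℝ) ^ (3 / 4 : ℝ) := fun j _ =>
      mul_nonneg (by positivity) (Real.rpow_nonneg (Real.log_natCast_nonneg _) _)
    rw [hEdef, ← ENNReal.ofReal_le_iff_le_toReal hfin, ENNReal.ofReal_sum_of_nonneg h0]
    exact ENNReal.sum_le_tsum F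
  have hkS' : (1100000 : ℝ) ^ 2 / ε ^ 4 * (lp + E) ^ 2 ≤ k := by
    rw [← ENNReal.ofReal_toReal hfin, ← ENNReal.ofReal_add hlp0 ENNReal.toReal_nonneg,
      ← ENNReal.ofReal_pow (by positivity), ← ENNReal.ofReal_mul hC.le,
      ← ENNReal.ofReal_natCast] at hkS
    exact (ENNReal.ofReal_le_ofReal_iff (Nat.cast_nonneg k)).1 hkS
  have hkE : 1100000 * (lp + E) ≤ ε ^ 2 * √(k : ℝ) := by
    have h1 : (1100000 * (lp + E) / ε ^ 2) ^ 2 ≤ k := by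
      refine le_trans (le_of_eq ?_) hkS'
      field_simp
    have h2 := Real.le_sqrt_of_sq_le h1
    rw [div_le_iff₀ (by positivity)] at h2
    linarith
  -- The additive constants in the levels L need ε√k to be large. For p ≤ 1/2 the log(1/p) term
  -- supplies this, at the cost of the factor 1/2; for p > 1/2 that term may vanish in the limit,
  -- and the separate lower bound on k is used.
  have hkε : 550000 ≤ ε * √(k : ℝ) := by
    rcases le_or_gt p (1 / 2) with hp2 | hp2
    · have h1 := half_le_log_rpow hp hp2
      have h2 : ε ^ 2 * √(k : ℝ) ≤ ε * √(k : ℝ) := by gcongr; nlinarith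
      linarith
    · have h1 : (1100000 / ε) ^ 2 ≤ (k : ℝ) := by rw [div_pow]; exact hkp hp2
      have h2 := Real.le_sqrt_of_sq_le h1
      rw [div_le_iff₀ hε] at h2
      linarith
  have hk : 4 ≤ k := by
    by_contra! hcon
    have h1 : (k : ℝ) ≤ 4 := by exact_mod_cast hcon.le
    have h2 : √(k : ℝ) ≤ 2 := Real.sqrt_le_iff.2 ⟨by norm_num, by linarith⟩
    nlinarith [Real.sqrt_nonneg (k : ℝ)]
  exact hB.measure_isJLMap_ge hk hξ hS hε hε1 hp hp1 hE hkE hkε
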